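/- **Setting and notation.** All balls $B_r(x)$ are open, and measures are Borel. Let $0<R\le\infty$ and let $\beta,\tau\ge 0$, $\Lambda\ge 1$ be finite. Let $(X,d,\mu)$ be a complete metric measure space in which all balls (of positive radius) have positive finite measure, and which is a PI space at scales $\le R$ with data $(\beta,\Lambda,\tau)$: for every $x\in X$ and every finite $0<r\le R$, $$\mu(B_{2r}(x))\le\beta\,\mu(B_r(x)),\qquad \int_{B_r(x)}|u-u_{x,r}|\,d\mu\le r\,\tau\int_{B_{\Lambda r}(x)}g\,d\mu$$ for every real function $u$ integrable on balls, with average $u_{x,r}$ over $B_r(x)$, and every upper gradient $g$ of $u$. Let $U\subset X$ be open and let $(Y,\nu)$ be a $\sigma$-finite measure space. For a map $h$ into a Banach space, $\operatorname{Lip}h(x)=\liminf_{r\to0}\sup_{d(x,x')<r}\|h(x)-h(x')\|/r$. For open $W$, $$\operatorname{VAR}(h,W)=\inf\,\liminf_i\int_W\operatorname{Lip}h_i\,d\mu$$ over all sequences of locally Lipschitz maps $h_i$ on $W$ with $h_i\to h$ in $L^1(W)$. The map $f$ belongs to $\operatorname{BV}(U,L^1(Y))$ if $f\in L^1(U,L^1(Y))$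 and $\operatorname{VAR}(f,U)<\infty$. A cut of $U$ is an element of $L^1(U)$ represented by the characteristic function of a set of finite measure. For $f\in L^1(U,L^1(Y))$ let $H\in L^1(U\times Y)$ and $g:Y\to L^1(U)$ be given by $H(x,\cdot)=f(x)$ and $g(y)=H(\cdot,y)$ almost everywhere. Let $\operatorname{Slice}(u,t)$ be $\{u\ge t\}$, $\emptyset$, $\{u\le t\}$ for $t>0$, $t=0$, $t<0$ respectively. The cut measure of $f$ is $\Sigma_f=\operatorname{Slice}_*(g_*\nu\times\mathcal L)$, where $\mathcal L$ is Lebesgue measure on $\mathbb R$. Its total perimeter measure is $\lambda_{\Sigma_f}(A)=\int\operatorname{Per}(E,U)(A)\,d\Sigma_f(E)$, where $\operatorname{Per}(E,U)$ is the perimeter measure of $E$: $\operatorname{Per}(E,U)(W)=\operatorname{VAR}(\chi_E,W)$ for open $W\subset U$, extended to all subsets of $U$ by outer regularity. **Proposition.** For all $\beta,\Lambda,\tau$ there is a constant $C<\infty$, depending only on $\beta,\Lambda,\tau$, such that for all $X,\mu,R,U,Y,\nu$ as above, every $f\in\operatorname{BV}(U,L^1(Y))$ and every $L\ge 0$: 1.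 If $f$ has an $L$-Lipschitz representative on $U$, or merely a representative that is $L$-Lipschitz on some neighbourhood of each point of $U$, then for all $x\in X$ and $r>0$, $$\lambda_{\Sigma_f}(B_r(x)\cap U)\le C L\,\mu(B_r(x)\cap U).$$ 2. Conversely, if $\lambda_{\Sigma_f}(B_r(x))\le L\,\mu(B_r(x))$ for every ball $B_r(x)\subset U$, then $f$ has a representative $F$ with the following properties: * $\|F(x)-F(y)\|_{L^1(Y)}\le C L\,d(x,y)$ for all $x,y\in U$ with $C\,d(x,y)\le R$ and $B_{C d(x,y)}(x)\subset U$; * $\|F(x)-F(y)\|_{L^1(Y)}\le C L\operatorname{length}(\gamma)$ for every curve $\gamma$ in $U$ from $x$ to $y$, i.e. $F$ is $CL$-Lipschitz for the inner length distance of $U$; * if any two points $x,y\in U$ are joined by a curve in $U$ of length at most $Q\,d(x,y)$, then $F$ is $CQL$-Lipschitz on $U$; * if $U=X$ and $R=\infty$, then $F$ is $CL$-Lipschitz on $X$. -/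

import Mathlib

open MeasureTheory Filter Topology Set Metric
open scoped ENNReal NNReal

noncomputable section

namespace TotalPerimeter

/-! ### PI spaces -/

/-- `g` is an upper gradient of the real function `f`: for every rectifiable curve
`c : [0, ℓ] → X` parametrized by arclength, `|f (c ℓ) - f (c 0)| ≤ ∫₀^ℓ g (c s) ds`. -/
def IsUpperGradient {X : Type*} [PseudoEMetricSpace X] [MeasurableSpace X]
    (g : X → ℝ≥0∞) (f : X → ℝ) : Prop :=
  Measurable g ∧ ∀ (ℓ : ℝ) (c : ℝ → X), 0 ≤ ℓ → HasUnitSpeedOn c (Icc 0 ℓ) →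
    edist (f (c ℓ)) (f (c 0)) ≤ ∫⁻ s in Icc 0 ℓ, g (c s)

/-- The doubling condition and the `(1,1)`-Poincaré inequality for all balls of radius at most `R`
(`R = ∞` is allowed), with doubling constant `β`, Poincaré constant `τ` and dilation `Λ`. Balls are
open, with positive and finite measure. A PI space is a *complete* metric space with such a
measure. -/
structure IsPIMeasure {X : Type*} [MetricSpace X] [MeasurableSpace X]
    (μ : Measure X) (R : ℝ≥0∞) (β Λ τ : ℝ≥0) : Prop where
  ball_pos : ∀ (x : X) (r : ℝ), 0 < r → 0 < μ (ball x r)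
  ball_lt_top : ∀ (x : X) (r : ℝ), μ (ball x r) < ∞
  doubling : ∀ (x : X) (r : ℝ), 0 < r → ENNReal.ofReal r ≤ R →
    μ (ball x (2 * r)) ≤ β * μ (ball x r)
  poincare : ∀ (f : X → ℝ) (g : X → ℝ≥0∞), (∀ x r, IntegrableOn f (ball x r) μ) →
    IsUpperGradient g f → ∀ (x : X) (r : ℝ), 0 < r → ENNReal.ofReal r ≤ R →
    ∫⁻ z in ball x r, ‖f z - ⨍ w in ball x r, f w ∂μ‖ₑ ∂μ
      ≤ ENNReal.ofReal r * τ * ∫⁻ z in ball x (Λ * r), g z ∂μ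

/-! ### Functions of bounded variation -/

/-- The pointwise Lipschitz constant
`Lip h (x) = liminf_{r → 0} sup_{d(x, x') < r} ‖h x - h x'‖ / r`. -/
def pointLip {X V : Type*} [PseudoMetricSpace X] [PseudoEMetricSpace V]
    (h : X → V) (x : X) : ℝ≥0∞ :=
  liminf (fun r : ℝ => (⨆ x' ∈ ball x r, edist (h x) (h x')) / ENNReal.ofReal r) (𝓝[>] 0)

/-- The variation `VAR(h, W)` of `h` in the open set `W`: the infimum of
`liminf ∫_W Lip h_i dμ` over all sequences of locally Lipschitz functions `h_i` on `W` converging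
to `h` in `L¹(W)`. Only the values of `h` and `h_i` on `W` matter. -/
def variation {X V : Type*} [MetricSpace X] [MeasurableSpace X] [NormedAddCommGroup V]
    (μ : Measure X) (h : X → V) (W : Set X) : ℝ≥0∞ :=
  ⨅ (hs : ℕ → X → V) (_ : ∀ i, LocallyLipschitzOn W (hs i))
    (_ : Tendsto (fun i => eLpNorm (hs i - h) 1 (μ.restrict W)) atTop (𝓝 0)),
    liminf (fun i => ∫⁻ x in W, pointLip (hs i) x ∂μ) atTop

/-- `h ∈ BV(U, V)`: `h ∈ L¹(U, V)` (in the sense of Bochner) and `h` has finite variation. -/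
def IsBV {X V : Type*} [MetricSpace X] [MeasurableSpace X] [NormedAddCommGroup V]
    (μ : Measure X) (U : Set X) (h : X → V) : Prop :=
  MemLp h 1 (μ.restrict U) ∧ variation μ h U < ∞

/-! ### Cuts, and the cut measure of an `L¹` map into `L¹` -/

/-- `L¹` spaces carry their Borel σ-algebra. -/
instance instMeasurableSpaceLp {α E : Type*} [MeasurableSpace α] [NormedAddCommGroup E]
    {p : ℝ≥0∞} [Fact (1 ≤ p)] {μ : Measure α} : MeasurableSpace (Lp E p μ) := borel _

instance instBorelSpaceLp {α E : Type*} [MeasurableSpace α] [NormedAddCommGroup E]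
    {p : ℝ≥0∞} [Fact (1 ≤ p)] {μ : Measure α} : BorelSpace (Lp E p μ) := ⟨rfl⟩

/-- The cuts of a measure space: the elements of `L¹` represented by characteristic functions of
(measurable) sets of finite measure, with the metric and the Borel structure of `L¹`. -/
def Cut {α : Type*} [MeasurableSpace α] (μ : Measure α) : Type _ :=
  {v : Lp ℝ 1 μ // ∃ (s : Set α) (hs : MeasurableSet s) (hμs : μ s ≠ ∞),
    v = indicatorConstLp 1 hs hμs (1 : ℝ)}

instance instMeasurableSpaceCut {α : Type*} [MeasurableSpace α] {μ : Measure α} :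
    MeasurableSpace (Cut μ) :=
  Subtype.instMeasurableSpace

/-- The set `{u ≥ t}` for `t > 0`, `∅` for `t = 0`, and `{u ≤ t}` for `t < 0`. -/
def sliceSet {α : Type*} (u : α → ℝ) (t : ℝ) : Set α :=
  {x | (0 < t ∧ t ≤ u x) ∨ (t < 0 ∧ u x ≤ t)}

theorem measurableSet_sliceSet {α : Type*} [MeasurableSpace α] {u : α → ℝ} (hu : Measurable u)
    (t : ℝ) : MeasurableSet (sliceSet u t) :=
  ((MeasurableSet.const _).inter (measurableSet_le measurable_const hu)).union
    ((MeasurableSet.const _).inter (measurableSet_le hu measurable_const))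

theorem measure_sliceSet_ne_top {α : Type*} [MeasurableSpace α] {μ : Measure α} {u : α → ℝ}
    (hu : MemLp u 1 μ) (t : ℝ) : μ (sliceSet u t) ≠ ∞ := by
  rcases eq_or_ne t 0 with rfl | ht
  · simp [sliceSet]
  · have h : 0 < ‖t‖₊ := nnnorm_pos.2 ht
    refine ne_top_of_le_ne_top
      (hu.meas_ge_lt_top one_ne_zero ENNReal.one_ne_top h.ne').ne (measure_mono ?_)
    rintro x (⟨h0, hx⟩ | ⟨h0, hx⟩)
    · change ‖t‖ ≤ ‖u x‖
      rw [Real.norm_of_nonneg h0.le, Real.norm_of_nonneg (h0.le.trans hx)]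
      exact hx
    · change ‖t‖ ≤ ‖u x‖
      rw [Real.norm_of_nonpos h0.le, Real.norm_of_nonpos (hx.trans h0.le)]
      linarith

/-- The map `Slice : L¹ × ℝ → Cut`. -/
def slice {α : Type*} [MeasurableSpace α] {μ : Measure α} (q : Lp ℝ 1 μ × ℝ) : Cut μ :=
  ⟨indicatorConstLp 1 (measurableSet_sliceSet (Lp.stronglyMeasurable q.1).measurable q.2)
    (measure_sliceSet_ne_top (Lp.memLp q.1) q.2) 1, _, _, _, rfl⟩

open Classical in
/-- The element `H ∈ L¹(X × Y)` corresponding to `f ∈ L¹(X, L¹(Y))`, i.e. `H(x, ·) = f(x)` in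
`L¹(Y)` for almost every `x`. It exists by Fubini's theorem whenever `f ∈ L¹(X, L¹(Y))`, and is
unique up to null sets; the value `0` is used only for other `f`. -/
def jointFunction {α Y : Type*} [MeasurableSpace α] [MeasurableSpace Y] (μ : Measure α)
    (ν : Measure Y) (f : α → Lp ℝ 1 ν) : α × Y → ℝ :=
  if h : ∃ H : α × Y → ℝ, Integrable H (μ.prod ν) ∧
      ∀ᵐ x ∂μ, (fun y => H (x, y)) =ᵐ[ν] f x
  then h.choose else 0

open Classical in
/-- The map `g : Y → L¹(X)` induced by `f ∈ L¹(X, L¹(Y))`: `g(y) = H(·, y)` when this function is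
in `L¹(X)`, which is the case for almost every `y`, and `g(y) = 0` otherwise. -/
def transpose {α Y : Type*} [MeasurableSpace α] [MeasurableSpace Y] (μ : Measure α)
    (ν : Measure Y) (f : α → Lp ℝ 1 ν) (y : Y) : Lp ℝ 1 μ :=
  if h : MemLp (fun x => jointFunction μ ν f (x, y)) 1 μ then h.toLp else 0

/-- The Borel measure `𝒯_f = g_* ν` on `L¹(X)`. -/
def tautMeasure {α Y : Type*} [MeasurableSpace α] [MeasurableSpace Y] (μ : Measure α)
    (ν : Measure Y) (f : α → Lp ℝ 1 ν) : Measure (Lp ℝ 1 μ) :=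
  ν.map (transpose μ ν f)

/-- The cut measure `Σ_f = Slice_* (𝒯_f × Lebesgue)` of an `L¹` map `f : X → L¹(Y)`. -/
def cutMeasure {α Y : Type*} [MeasurableSpace α] [MeasurableSpace Y] (μ : Measure α)
    (ν : Measure Y) (f : α → Lp ℝ 1 ν) : Measure (Cut μ) :=
  ((tautMeasure μ ν f).prod volume).map slice

/-! ### The total perimeter measure -/

/-- The perimeter measure `Per(E, U)` of a cut `E` of the open set `U`, evaluated at `A ⊆ U`:
it is `VAR(χ_E, A)` for `A` open, and is extended to all sets by outer regularity. -/
def perimeterMeasure {X : Type*} [MetricSpace X] [MeasurableSpace X] (μ : Measure X) (U : Set X)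
    (E : Cut (μ.restrict U)) (A : Set X) : ℝ≥0∞ :=
  ⨅ (W : Set X) (_ : IsOpen W) (_ : A ⊆ W) (_ : W ⊆ U), variation μ E.1 W

/-- The total perimeter measure of a cut measure `S` on `Cut(U)`, evaluated at `A ⊆ U`:
`λ_S(A) = ∫ Per(E, U)(A) dS(E)`. -/
def totalPerimeter {X : Type*} [MetricSpace X] [MeasurableSpace X] (μ : Measure X) (U : Set X)
    (S : Measure (Cut (μ.restrict U))) (A : Set X) : ℝ≥0∞ :=
  ∫⁻ E, perimeterMeasure μ U E A ∂S

end TotalPerimeter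

end

/-! The set of levels `t` whose slices separate two real values `a` and `b` has length |a - b|. By
Tonelli, `f` is therefore a superposition of cuts: ‖f z - f w‖ is the integral of |χ_E z - χ_E w|
against `Σ_f`, in the sense of integrals over pairs (z, w). So the oscillation `doubleOsc`, the
integral of ‖f z - f w‖ over B × B, is additive over cuts (`lintegral_doubleOsc_cutMeasure`). It
replaces the deviation from the mean because no average of a cut enters it.

From perimeter to Lipschitz: the Poincaré inequality passes from locally Lipschitz to BV functions.
Applied to each cut and integrated, it bounds the oscillation of `f` on a ball of radius s by s μ(B)
times the total perimeter of a larger concentric ball, hence by a multiple of L s μ(B)²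
(`doubleOsc_le_totalPerimeter`). Campanato's argument then applies: averages over balls shrinking to
a point form a geometric series, and their limits are a representative that is Lipschitz at
distances small compared with the distance to the complement of `U`
(`exists_lipschitz_representative`). Subdividing a curve gives the statements about inner length.

From Lipschitz to perimeter only doubling is needed. For each y the scalar function H(·, y) is
averaged against tents whose radius is itself a 1-Lipschitz function, positive on the open set `A`
and so small that all balls involved stay in `A`. The slope of the average at z is at most a
multiple of the normalized oscillation `tentOsc` around z, and the integral of the latter over `Y`
is at most a multiple of `L` (`lintegral_tentOsc_le`). A coarea inequality
(`lintegral_variation_sliceInd_le`) and Fatou's lemma turn this into the bound on the total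
perimeter.

Measurability of the perimeter as a function of the cut is never needed: one direction uses only
monotonicity of the integral, the other only inequalities valid for arbitrary functions. -/

namespace TotalPerimeter

/-! ### The pointwise Lipschitz constant -/

section PointLip

variable {X V : Type*} [PseudoMetricSpace X] [PseudoEMetricSpace V]

theorem pointLip_le {h : X → V} {x : X} {K : ℝ≥0∞}
    (hK : ∀ᶠ x' in 𝓝 x, edist (h x) (h x') ≤ K * edist x x') : pointLip h x ≤ K := by
  obtain ⟨ε, hε, hb⟩ := Metric.eventually_nhds_iff_ball.1 hK
  refine liminf_le_of_frequently_le' (Eventually.frequently ?_)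
  filter_upwards [Ioo_mem_nhdsGT hε] with r hr
  refine ENNReal.div_le_of_le_mul (iSup₂_le fun x' hx' => ?_)
  refine (hb x' (ball_subset_ball hr.2.le hx')).trans ?_
  gcongr
  rw [edist_comm, edist_dist]
  exact ENNReal.ofReal_le_ofReal (mem_ball.1 hx').le

/-- The supremum over a ball increases with the radius, so for rational q increasing to r the
quotient at q is at most (supremum at r) / q, which tends to the quotient at r. Rational radii
therefore suffice, and only countably many operations remain, as measurability requires. -/
theorem pointLip_eq_iSup_iInf {W : Set X} (hW : IsOpen W) (h : X → V) {x : X} (hx : x ∈ W) :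
    pointLip h x = ⨆ n : ℕ, ⨅ q : ℚ, ⨅ (_ : 0 < q ∧ (q : ℝ) < 1 / (n + 1)),
      (⨆ x' ∈ ball x (q : ℝ) ∩ W, edist (h x) (h x')) / ENNReal.ofReal q := by
  obtain ⟨ε₀, hε₀, hball⟩ := Metric.isOpen_iff.1 hW x hx
  have hinter : ∀ r ≤ ε₀, ball x r ∩ W = ball x r := fun r hr =>
    inter_eq_left.2 ((ball_subset_ball hr).trans hball)
  rw [pointLip, (nhdsGT_basis (0 : ℝ)).liminf_eq_iSup_iInf]
  apply le_antisymm
  · refine iSup₂_le fun ε hε => ?_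
    obtain ⟨n, hn⟩ := exists_nat_one_div_lt (lt_min hε hε₀)
    refine le_iSup_of_le n (le_iInf₂ fun q hq => ?_)
    have hqε : (q : ℝ) < min ε ε₀ := hq.2.trans hn
    refine (iInf₂_le (q : ℝ) ⟨by exact_mod_cast hq.1, hqε.trans_le (min_le_left _ _)⟩).trans ?_
    rw [hinter q (hqε.le.trans (min_le_right _ _))]
  · refine iSup_le fun n => ?_
    have hn : (0 : ℝ) < 1 / (n + 1) := by positivity
    refine le_iSup₂_of_le (min (1 / ((n : ℝ) + 1)) ε₀) (lt_min hn hε₀) (le_iInf₂ fun r hr => ?_)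
    set a := ⨅ q : ℚ, ⨅ (_ : 0 < q ∧ (q : ℝ) < 1 / ((n : ℝ) + 1)),
      (⨆ x' ∈ ball x (q : ℝ) ∩ W, edist (h x) (h x')) / ENNReal.ofReal q with ha
    have hr0 : (0 : ℝ) < r := hr.1
    have hrn : r < 1 / ((n : ℝ) + 1) := hr.2.trans_le (min_le_left _ _)
    rw [ENNReal.le_div_iff_mul_le (Or.inl (by simpa using hr0)) (Or.inl ENNReal.ofReal_ne_top)]
    obtain ⟨q, -, hq1, hq2⟩ : ∃ q : ℕ → ℚ, StrictMono q ∧ (∀ k, (q k : ℝ) < r) ∧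
        Tendsto (fun k => (q k : ℝ)) atTop (𝓝 r) := by
      obtain ⟨q, hqm, hq, hqt⟩ := Real.exists_seq_rat_strictMono_tendsto r
      exact ⟨q, hqm, hq, hqt⟩
    have ht : Tendsto (fun k => a * ENNReal.ofReal (q k)) atTop (𝓝 (a * ENNReal.ofReal r)) := by
      refine ENNReal.Tendsto.const_mul (ENNReal.tendsto_ofReal hq2) (Or.inl ?_)
      simpa using hr0
    refine le_of_tendsto ht ?_
    filter_upwards [hq2.eventually_const_lt hr0] with k hk
    have hk0 : 0 < q k := by exact_mod_cast hk
    have h1 : a ≤ (⨆ x' ∈ ball x r, edist (h x) (h x')) / ENNReal.ofReal (q k) := by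
      refine (iInf₂_le (q k) ⟨hk0, (hq1 k).trans hrn⟩).trans ?_
      exact ENNReal.div_le_div_right
        (biSup_mono fun x' hx' => ball_subset_ball (hq1 k).le hx'.1) _
    rwa [ENNReal.le_div_iff_mul_le (Or.inl (by simpa using hk)) (Or.inl ENNReal.ofReal_ne_top)]
      at h1

/-- For a fixed radius the supremum is lower semicontinuous: a point x' witnessing a value above a
still lies in the open ball, and still witnesses it, when the centre moves slightly. -/
theorem measurable_indicator_pointLip [MeasurableSpace X] [BorelSpace X] {W : Set X}
    (hW : IsOpen W) {h : X → V} (hh : ContinuousOn h W) :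
    Measurable (W.indicator (pointLip h)) := by
  have hG : ∀ q : ℝ, Measurable (W.indicator fun x => ⨆ x' ∈ ball x q ∩ W, edist (h x) (h x')) := by
    intro q
    refine measurable_of_Ioi fun a => IsOpen.measurableSet ?_
    rw [isOpen_iff_mem_nhds]
    intro x hx
    by_cases hxW : x ∈ W
    · rw [mem_preimage, indicator_of_mem hxW, mem_Ioi, lt_iSup_iff] at hx
      obtain ⟨x', hx⟩ := hx
      obtain ⟨hx', hx⟩ := lt_iSup_iff.1 hx
      have hc : ContinuousAt (fun z => edist (h z) (h x')) x :=
        ((hh.continuousAt (hW.mem_nhds hxW)).edist continuousAt_const)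
      filter_upwards [hW.mem_nhds hxW, hc.eventually_const_lt hx,
        isOpen_ball.mem_nhds (mem_ball_comm.1 hx'.1)] with z hzW hz hzb
      rw [mem_preimage, indicator_of_mem hzW, mem_Ioi]
      exact hz.trans_le (le_iSup₂_of_le x' ⟨mem_ball_comm.1 hzb, hx'.2⟩ le_rfl)
    · rw [mem_preimage, indicator_of_notMem hxW] at hx
      exact absurd hx (by simp)
  have hmeas : Measurable fun x => ⨆ n : ℕ, ⨅ q : ℚ, ⨅ (_ : 0 < q ∧ (q : ℝ) < 1 / ((n : ℝ) + 1)),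
      (W.indicator (fun x => ⨆ x' ∈ ball x (q : ℝ) ∩ W, edist (h x) (h x')) x)
        / ENNReal.ofReal q :=
    Measurable.iSup fun n => Measurable.iInf fun q => Measurable.iInf fun _ =>
      (hG q).div_const _
  convert hmeas.indicator hW.measurableSet using 1
  refine indicator_congr fun x hx => ?_
  simp only [pointLip_eq_iSup_iInf hW h hx, indicator_of_mem hx]

theorem enorm_deriv_le_pointLip {h : X → ℝ} {c : ℝ → X} {a b s : ℝ}
    (hs : s ∈ Ioo a b) (hc : LipschitzOnWith 1 c (Icc a b)) (hhc : ContinuousOn (h ∘ c) (Icc a b))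
    (hd : DifferentiableAt ℝ (h ∘ c) s) : ‖deriv (h ∘ c) s‖ₑ ≤ pointLip h (c s) := by
  have ht := hd.hasDerivAt.tendsto_slope_zero_right.enorm
  rw [← ht.liminf_eq]
  refine liminf_le_liminf ?_
  filter_upwards [Ioo_mem_nhdsGT (sub_pos.2 hs.2)] with r hr
  rw [ENNReal.le_div_iff_mul_le (Or.inl (by simpa using hr.1)) (Or.inl ENNReal.ofReal_ne_top),
    enorm_smul, enorm_inv hr.1.ne', Real.enorm_eq_ofReal hr.1.le, mul_comm, ← mul_assoc,
    ENNReal.mul_inv_cancel (by simpa using hr.1) ENNReal.ofReal_ne_top, one_mul, ← edist_eq_enorm_sub,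
    edist_comm]
  have hsr : s + r ∈ Ioo a b := ⟨by linarith [hs.1, hr.1], by linarith [hr.2]⟩
  -- The balls in `pointLip` are open, and c (s + r) may be at distance exactly r from c s. The
  -- points c u with u < s + r do lie in the ball; then u tends to s + r.
  have hcont : Tendsto (fun u => edist ((h ∘ c) s) ((h ∘ c) u)) (𝓝[<] (s + r))
      (𝓝 (edist ((h ∘ c) s) ((h ∘ c) (s + r)))) :=
    (tendsto_const_nhds.edist (hhc.continuousAt (Icc_mem_nhds hsr.1 hsr.2))).mono_left
      nhdsWithin_le_nhds
  refine le_of_tendsto hcont ?_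
  filter_upwards [Ioo_mem_nhdsLT (show s < s + r by linarith [hr.1])] with u hu
  refine le_iSup₂_of_le (f := fun x' _ => edist (h (c s)) (h x')) (c u) ?_ le_rfl
  have := hc.dist_le_mul u ⟨by linarith [hs.1, hu.1], by linarith [hsr.2, hu.2]⟩ s ⟨hs.1.le, hs.2.le⟩
  rw [mem_ball]
  refine this.trans_lt ?_
  rw [Real.dist_eq, abs_of_pos (by linarith [hu.1])]
  simp; linarith [hu.2]

theorem lipschitzOnWith_one_of_hasUnitSpeedOn {c : ℝ → X} {s : Set ℝ} (hc : HasUnitSpeedOn c s) :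
    LipschitzOnWith 1 c s := by
  have key : ∀ u ∈ s, ∀ v ∈ s, u ≤ v → edist (c u) (c v) ≤ edist u v := by
    intro u hu v hv huv
    refine (eVariationOn.edist_le c (s := s ∩ Icc u v) ⟨hu, le_rfl, huv⟩ ⟨hv, huv, le_rfl⟩).trans ?_
    rw [hc hu hv, edist_comm, edist_dist, Real.dist_eq, abs_of_nonneg (sub_nonneg.2 huv)]
    simp
  intro u hu v hv
  rw [ENNReal.coe_one, one_mul]
  rcases le_total u v with huv | huv
  · exact key u hu v hv huv
  · rw [edist_comm, edist_comm u v]; exact key v hv u hu huv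

/-- On a compact curve a locally Lipschitz function is Lipschitz, hence absolutely continuous, hence
the integral of its derivative; `pointLip` dominates that derivative wherever it exists. -/
theorem edist_le_lintegral_pointLip {W : Set X} {h : X → ℝ}
    (hh : LocallyLipschitzOn W h) {ℓ : ℝ} (hℓ : 0 ≤ ℓ) {c : ℝ → X}
    (hc : HasUnitSpeedOn c (Icc 0 ℓ)) (hcW : MapsTo c (Icc 0 ℓ) W) :
    edist (h (c ℓ)) (h (c 0)) ≤ ∫⁻ s in Icc 0 ℓ, pointLip h (c s) := by
  have hc1 := lipschitzOnWith_one_of_hasUnitSpeedOn hc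
  have hloc : LocallyLipschitzOn (Icc 0 ℓ) (h ∘ c) := by
    intro s hs
    obtain ⟨K, t, ht, hK⟩ := hh (hcW hs)
    have hmem : c ⁻¹' t ∈ 𝓝[Icc 0 ℓ] s :=
      (hc1.continuousOn s hs).tendsto_nhdsWithin hcW ht
    exact ⟨K * 1, c ⁻¹' t ∩ Icc 0 ℓ, inter_mem hmem self_mem_nhdsWithin,
      hK.comp (hc1.mono inter_subset_right) (fun _ hx => hx.1)⟩
  obtain ⟨K, hK⟩ := hloc.exists_lipschitzOnWith_of_compact isCompact_Icc
  have hac : AbsolutelyContinuousOnInterval (h ∘ c) 0 ℓ :=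
    LipschitzOnWith.absolutelyContinuousOnInterval (by rwa [uIcc_of_le hℓ])
  have hdiff := hac.ae_differentiableAt
  have hint := hac.integral_deriv_eq_sub
  rw [intervalIntegral.integral_of_le hℓ] at hint
  change edist ((h ∘ c) ℓ) ((h ∘ c) 0) ≤ _
  rw [edist_eq_enorm_sub, ← hint, ← restrict_Ioo_eq_restrict_Ioc]
  refine (enorm_integral_le_lintegral_enorm _).trans ?_
  refine le_trans ?_ (lintegral_mono_set Ioo_subset_Icc_self)
  refine setLIntegral_mono_ae' measurableSet_Ioo ?_
  filter_upwards [hdiff] with s hs hsm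
  refine enorm_deriv_le_pointLip hsm hc1 hK.continuousOn (hs ?_)
  rw [uIcc_of_le hℓ]; exact Ioo_subset_Icc_self hsm

end PointLip

/-! ### Variation and perimeter measure of open sets -/

section Variation

variable {X V : Type*} [MetricSpace X] [MeasurableSpace X] [NormedAddCommGroup V] {μ : Measure X}

theorem variation_le {h : X → V} {W : Set X} {hs : ℕ → X → V}
    (hL : ∀ i, LocallyLipschitzOn W (hs i))
    (ht : Tendsto (fun i => eLpNorm (hs i - h) 1 (μ.restrict W)) atTop (𝓝 0)) :
    variation μ h W ≤ liminf (fun i => ∫⁻ x in W, pointLip (hs i) x ∂μ) atTop :=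
  iInf_le_of_le hs (iInf_le_of_le hL (iInf_le _ ht))

theorem le_variation {h : X → V} {W : Set X} {b : ℝ≥0∞}
    (hb : ∀ hs : ℕ → X → V, (∀ i, LocallyLipschitzOn W (hs i)) →
      Tendsto (fun i => eLpNorm (hs i - h) 1 (μ.restrict W)) atTop (𝓝 0) →
      b ≤ liminf (fun i => ∫⁻ x in W, pointLip (hs i) x ∂μ) atTop) :
    b ≤ variation μ h W :=
  le_iInf fun hs => le_iInf fun hL => le_iInf fun ht => hb hs hL ht

theorem variation_mono_set (h : X → V) {W W' : Set X} (hW : W ⊆ W') :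
    variation μ h W ≤ variation μ h W' := by
  refine le_variation fun hs hL ht => ?_
  refine (variation_le (fun i => (hL i).mono hW) ?_).trans
    (liminf_le_liminf (Eventually.of_forall fun i => lintegral_mono_set hW))
  exact tendsto_of_tendsto_of_tendsto_of_le_of_le tendsto_const_nhds ht (fun _ => zero_le)
    (fun i => eLpNorm_mono_measure _ (Measure.restrict_mono hW le_rfl))

theorem variation_le_of_ae_eq {h h' : X → V} {W : Set X} (hh : h =ᵐ[μ.restrict W] h') :
    variation μ h W ≤ variation μ h' W := by
  refine le_variation fun hs hL ht => variation_le hL ?_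
  refine ht.congr fun i => eLpNorm_congr_ae ?_
  filter_upwards [hh] with x hx
  simp [hx]

theorem perimeterMeasure_of_isOpen {U A : Set X} (hA : IsOpen A) (hAU : A ⊆ U)
    (E : Cut (μ.restrict U)) : perimeterMeasure μ U E A = variation μ E.1 A :=
  le_antisymm (iInf_le_of_le A (iInf_le_of_le hA (iInf_le_of_le le_rfl (iInf_le _ hAU))))
    (le_iInf fun _ => le_iInf fun _ => le_iInf fun hW => le_iInf fun _ => variation_mono_set _ hW)

end Variation

/-! ### The Poincaré inequality for functions of bounded variation -/

section Poincare

/-- The mean oscillation of `u` over `B`, up to the normalization by `(μ B)²`. -/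
noncomputable def doubleOsc {X V : Type*} [MeasurableSpace X] [NormedAddCommGroup V] (μ : Measure X)
    (B : Set X) (u : X → V) : ℝ≥0∞ :=
  ∫⁻ z in B, ∫⁻ w in B, ‖u z - u w‖ₑ ∂μ ∂μ

theorem doubleOsc_le_of_const {X : Type*} [MeasurableSpace X] {μ : Measure X}
    {B : Set X} {u : X → ℝ} (hu : AEStronglyMeasurable u (μ.restrict B)) (c : ℝ) :
    doubleOsc μ B u ≤ 2 * μ B * ∫⁻ z in B, ‖u z - c‖ₑ ∂μ := by
  have hm : AEMeasurable (fun z => ‖u z - c‖ₑ) (μ.restrict B) :=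
    (hu.sub aestronglyMeasurable_const).enorm
  calc doubleOsc μ B u ≤ ∫⁻ z in B, ∫⁻ w in B, (‖u z - c‖ₑ + ‖u w - c‖ₑ) ∂μ ∂μ := by
        refine lintegral_mono fun z => lintegral_mono fun w => ?_
        rw [show u z - u w = (u z - c) - (u w - c) by ring]
        exact enorm_sub_le
    _ = ∫⁻ z in B, (‖u z - c‖ₑ * μ B + ∫⁻ w in B, ‖u w - c‖ₑ ∂μ) ∂μ := by
        refine lintegral_congr fun z => ?_
        rw [lintegral_add_left measurable_const]; simp
    _ = 2 * μ B * ∫⁻ z in B, ‖u z - c‖ₑ ∂μ := by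
        rw [lintegral_add_right _ measurable_const, lintegral_mul_const'' _ hm]
        simp only [lintegral_const, Measure.restrict_apply_univ]
        ring

theorem doubleOsc_le_add {X V : Type*} [MeasurableSpace X] [NormedAddCommGroup V] {μ : Measure X}
    {B : Set X} {u v : X → V}
    (huv : AEStronglyMeasurable (u - v) (μ.restrict B)) :
    doubleOsc μ B u ≤ doubleOsc μ B v + 2 * μ B * ∫⁻ z in B, ‖u z - v z‖ₑ ∂μ := by
  have hm : AEMeasurable (fun z => ‖u z - v z‖ₑ) (μ.restrict B) := huv.enorm
  calc doubleOsc μ B u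
      ≤ ∫⁻ z in B, ∫⁻ w in B, (‖v z - v w‖ₑ + (‖u z - v z‖ₑ + ‖u w - v w‖ₑ)) ∂μ ∂μ := by
        refine lintegral_mono fun z => lintegral_mono fun w => ?_
        rw [show u z - u w = (v z - v w) + ((u z - v z) - (u w - v w)) by abel]
        exact (enorm_add_le _ _).trans (add_le_add le_rfl enorm_sub_le)
    _ = ∫⁻ z in B, (∫⁻ w in B, ‖v z - v w‖ₑ ∂μ
          + (‖u z - v z‖ₑ * μ B + ∫⁻ w in B, ‖u w - v w‖ₑ ∂μ)) ∂μ := by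
        refine lintegral_congr fun z => ?_
        have hz : AEMeasurable (fun w => ‖u z - v z‖ₑ + ‖u w - v w‖ₑ) (μ.restrict B) :=
          aemeasurable_const.add hm
        rw [lintegral_add_right' _ hz, lintegral_add_left measurable_const]; simp
    _ = doubleOsc μ B v + 2 * μ B * ∫⁻ z in B, ‖u z - v z‖ₑ ∂μ := by
        have hz : AEMeasurable (fun z => ‖u z - v z‖ₑ * μ B + ∫⁻ w in B, ‖u w - v w‖ₑ ∂μ)
            (μ.restrict B) := (hm.mul_const _).add aemeasurable_const
        rw [lintegral_add_right' _ hz,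
          lintegral_add_right _ measurable_const, lintegral_mul_const'' _ hm]
        simp only [lintegral_const, Measure.restrict_apply_univ, doubleOsc]
        ring

variable {X : Type*} [MetricSpace X] [MeasurableSpace X] [BorelSpace X]
  {μ : Measure X} {R : ℝ≥0∞} {β Λ τ : ℝ≥0}

/-- The Poincaré inequality concerns functions on all of `X`, while `v` is controlled on `W` only.
An infinite weight off `K` makes the extension by zero harmless: a nonconstant curve that leaves the
closed set `K` does so for a set of times of positive measure. -/
theorem isUpperGradient_of_locallyLipschitzOn {W : Set X} (hW : IsOpen W) {v : X → ℝ}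
    (hv : LocallyLipschitzOn W v) {K : Set X} (hK : IsClosed K) (hKW : K ⊆ W) :
    IsUpperGradient (fun z => Kᶜ.indicator ⊤ z + W.indicator (pointLip v) z)
      (W.indicator v) := by
  refine ⟨(measurable_const.indicator hK.measurableSet.compl).add
    (measurable_indicator_pointLip hW hv.continuousOn), fun ℓ c hℓ hc => ?_⟩
  by_cases hcK : MapsTo c (Icc 0 ℓ) K
  · have hcW : MapsTo c (Icc 0 ℓ) W := fun s hs => hKW (hcK hs)
    rw [indicator_of_mem (hcW ⟨hℓ, le_rfl⟩), indicator_of_mem (hcW ⟨le_rfl, hℓ⟩)]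
    refine (edist_le_lintegral_pointLip hv hℓ hc hcW).trans ?_
    refine setLIntegral_mono' measurableSet_Icc fun s hs => ?_
    simp only [indicator_of_mem (hcW hs)]
    exact le_add_self
  · rcases hℓ.eq_or_lt with rfl | hℓ
    · simp
    suffices h : ∫⁻ s in Icc 0 ℓ, (Kᶜ.indicator ⊤ (c s) + W.indicator (pointLip v) (c s)) = ⊤ by
      rw [h]; exact le_top
    have hcont : ContinuousOn c (Icc 0 ℓ) := (lipschitzOnWith_one_of_hasUnitSpeedOn hc).continuousOn
    obtain ⟨s, hs, hsK⟩ : ∃ s ∈ Icc 0 ℓ, c s ∉ K := by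
      simpa only [MapsTo, not_forall, exists_prop] using hcK
    -- The time spent outside `K` might only be known at an endpoint of the interval; an interior
    -- time is needed to get a nonempty open set of times.
    obtain ⟨s', hs', hs'K⟩ : ∃ s ∈ Ioo 0 ℓ, c s ∉ K := by
      have hmem : c ⁻¹' Kᶜ ∈ 𝓝[Icc 0 ℓ] s := hcont s hs (hK.isOpen_compl.mem_nhds hsK)
      have hmem' : s ∈ closure (Ioo 0 ℓ) := by rwa [closure_Ioo hℓ.ne]
      have := mem_closure_iff_nhdsWithin_neBot.1 hmem'
      obtain ⟨s', h1, h2⟩ := Filter.nonempty_of_mem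
        (inter_mem (nhdsWithin_mono s Ioo_subset_Icc_self hmem) self_mem_nhdsWithin)
      exact ⟨s', h2, h1⟩
    have hO : IsOpen (Ioo 0 ℓ ∩ c ⁻¹' Kᶜ) :=
      (hcont.mono Ioo_subset_Icc_self).isOpen_inter_preimage isOpen_Ioo hK.isOpen_compl
    have hpos : 0 < volume (Ioo 0 ℓ ∩ c ⁻¹' Kᶜ) := hO.measure_pos _ ⟨s', hs', hs'K⟩
    rw [eq_top_iff]
    calc (⊤ : ℝ≥0∞) = ∫⁻ s in Ioo 0 ℓ ∩ c ⁻¹' Kᶜ, ⊤ := by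
          rw [setLIntegral_const, ENNReal.top_mul hpos.ne']
      _ ≤ ∫⁻ s in Ioo 0 ℓ ∩ c ⁻¹' Kᶜ, (Kᶜ.indicator ⊤ (c s) + W.indicator (pointLip v) (c s)) := by
          refine setLIntegral_mono' hO.measurableSet fun s hs => ?_
          rw [indicator_of_mem (show c s ∈ Kᶜ from hs.2)]; simp
      _ ≤ _ := lintegral_mono_set (inter_subset_left.trans Ioo_subset_Icc_self)

/-- With the closed ball of radius Λs as `K`, the infinite part of the upper gradient lies outside
the ball over which the Poincaré inequality integrates it. -/
theorem IsPIMeasure.doubleOsc_le_of_locallyLipschitzOn (h : IsPIMeasure μ R β Λ τ) (hΛ : 1 ≤ Λ)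
    {x : X} {s : ℝ} (hs : 0 < s) (hsR : ENNReal.ofReal s ≤ R) {W : Set X} (hW : IsOpen W)
    (hxW : closedBall x (Λ * s) ⊆ W) {v : X → ℝ} (hv : LocallyLipschitzOn W v)
    (hvi : IntegrableOn v W μ) :
    doubleOsc μ (ball x s) v
      ≤ 2 * μ (ball x s) * (ENNReal.ofReal s * τ) * ∫⁻ z in W, pointLip v z ∂μ := by
  have hB : ball x s ⊆ closedBall x (Λ * s) :=
    ball_subset_closedBall.trans (closedBall_subset_closedBall
      (le_mul_of_one_le_left hs.le (by exact_mod_cast hΛ)))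
  have hP := h.poincare (W.indicator v) _
    (fun _ _ => ((integrable_indicator_iff hW.measurableSet).2 hvi).integrableOn)
    (isUpperGradient_of_locallyLipschitzOn hW hv isClosed_closedBall hxW) x s hs hsR
  have h1 : ∫⁻ z in ball x s, ‖v z - ⨍ w in ball x s, W.indicator v w ∂μ‖ₑ ∂μ
      ≤ ENNReal.ofReal s * τ * ∫⁻ z in W, pointLip v z ∂μ := by
    refine le_trans (le_of_eq ?_) (hP.trans ?_)
    · refine setLIntegral_congr_fun measurableSet_ball fun z hz => ?_
      simp only [indicator_of_mem (hxW (hB hz))]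
    · refine mul_le_mul_right ?_ _
      refine le_trans (b := ∫⁻ z in ball x (Λ * s), pointLip v z ∂μ) (le_of_eq ?_)
        (lintegral_mono_set (ball_subset_closedBall.trans hxW))
      refine setLIntegral_congr_fun measurableSet_ball fun z hz => ?_
      have hz' := ball_subset_closedBall hz
      simp only [indicator_of_mem (hxW hz'), indicator_of_notMem (notMem_compl_iff.2 hz'), zero_add]
  refine (doubleOsc_le_of_const (hvi.mono_set (hB.trans hxW)).aestronglyMeasurable
    (⨍ w in ball x s, W.indicator v w ∂μ)).trans ?_
  rw [mul_assoc (2 * μ (ball x s))]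
  exact mul_le_mul_right h1 _

/-- The left side is continuous under L¹ convergence, so the bound for the locally Lipschitz
approximations survives the lower limit. -/
theorem IsPIMeasure.doubleOsc_le_variation (h : IsPIMeasure μ R β Λ τ) (hΛ : 1 ≤ Λ)
    {x : X} {s : ℝ} (hs : 0 < s) (hsR : ENNReal.ofReal s ≤ R) {W : Set X} (hW : IsOpen W)
    (hxW : closedBall x (Λ * s) ⊆ W) {u : X → ℝ} (hu : IntegrableOn u W μ) :
    doubleOsc μ (ball x s) u
      ≤ 2 * μ (ball x s) * (ENNReal.ofReal s * (τ + 1)) * variation μ u W := by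
  have hB : ball x s ⊆ W := (ball_subset_closedBall.trans (closedBall_subset_closedBall
      (le_mul_of_one_le_left hs.le (by exact_mod_cast hΛ)))).trans hxW
  -- Having `τ + 1` instead of `τ` makes this constant nonzero; being finite as well, it may be
  -- moved through the infima that define `variation`.
  set K := 2 * μ (ball x s) * (ENNReal.ofReal s * (τ + 1)) with hK
  have hKt : K ≠ ⊤ :=
    ENNReal.mul_ne_top (ENNReal.mul_ne_top (by simp) (h.ball_lt_top x s).ne)
      (ENNReal.mul_ne_top (by simp) (by simp))
  have hK0 : K ≠ 0 := mul_ne_zero (mul_ne_zero two_ne_zero (h.ball_pos x s hs).ne')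
    (mul_ne_zero (by simpa using hs) (by simp))
  have hmain : ∀ hs : ℕ → X → ℝ, (∀ i, LocallyLipschitzOn W (hs i)) →
      Tendsto (fun i => eLpNorm (hs i - u) 1 (μ.restrict W)) atTop (𝓝 0) →
      doubleOsc μ (ball x s) u ≤ K * liminf (fun i => ∫⁻ z in W, pointLip (hs i) z ∂μ) atTop := by
    intro v hv ht
    have hlim : Tendsto (fun i => 2 * μ (ball x s) * eLpNorm (v i - u) 1 (μ.restrict W)) atTop
        (𝓝 0) := by
      have hBt : 2 * μ (ball x s) ≠ ∞ := ENNReal.mul_ne_top (by simp) (h.ball_lt_top x s).ne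
      have := ENNReal.Tendsto.const_mul ht (Or.inr hBt)
      rwa [mul_zero] at this
    rw [← ENNReal.liminf_const_mul_of_ne_top hKt, ← ENNReal.liminf_add_of_right_tendsto_zero hlim]
    refine le_liminf_of_le (by isBoundedDefault) ?_
    filter_upwards [ht.eventually_lt_const ENNReal.zero_lt_top] with i hi
    have hvm : AEStronglyMeasurable (v i) (μ.restrict W) :=
      ((hv i).continuousOn.aemeasurable hW.measurableSet).aestronglyMeasurable
    have hvu : Integrable (v i - u) (μ.restrict W) :=
      memLp_one_iff_integrable.1 ⟨hvm.sub hu.aestronglyMeasurable, hi⟩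
    have hvi : IntegrableOn (v i) W μ := by
      have := hvu.add hu
      rwa [sub_add_cancel] at this
    refine (doubleOsc_le_add (v := v i) ?_).trans (add_le_add ?_ ?_)
    · exact (hu.aestronglyMeasurable.sub hvm).mono_measure (Measure.restrict_mono hB le_rfl)
    · exact (h.doubleOsc_le_of_locallyLipschitzOn hΛ hs hsR hW hxW (hv i) hvi).trans
        (mul_le_mul_left (mul_le_mul_right (mul_le_mul_right le_self_add _) _) _)
    · refine mul_le_mul_right ((lintegral_mono_set hB).trans (le_of_eq ?_)) _
      rw [eLpNorm_one_eq_lintegral_enorm]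
      refine lintegral_congr fun z => ?_
      rw [Pi.sub_apply, enorm_sub_rev]
  rw [variation]
  simp only [ENNReal.mul_iInf_of_ne hK0 hKt]
  exact le_iInf fun v => le_iInf fun hv => le_iInf fun ht => hmain v hv ht

end Poincare

/-! ### Elementary consequences of the PI conditions -/

namespace IsPIMeasure

variable {X : Type*} [MetricSpace X] [MeasurableSpace X] {μ : Measure X} {R : ℝ≥0∞}
  {β Λ τ : ℝ≥0}

theorem isLocallyFiniteMeasure (h : IsPIMeasure μ R β Λ τ) : IsLocallyFiniteMeasure μ :=
  ⟨fun x => ⟨ball x 1, ball_mem_nhds x one_pos, h.ball_lt_top x 1⟩⟩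

theorem sigmaFinite (h : IsPIMeasure μ R β Λ τ) : SigmaFinite μ := by
  rcases isEmpty_or_nonempty X with hX | ⟨⟨x⟩⟩
  · rw [Measure.eq_zero_of_isEmpty μ]; infer_instance
  · exact ⟨⟨{ set := fun n => ball x n
              set_mem := fun _ => trivial
              finite := fun n => h.ball_lt_top x n
              spanning := iUnion_ball_nat x }⟩⟩

/-- Disjoint balls of positive measure in a σ-finite space are countably many. By Vitali covering,
the centres of suitable disjoint balls of radius ε/5 are ε-dense. -/
theorem secondCountableTopology [BorelSpace X] (h : IsPIMeasure μ R β Λ τ) :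
    SecondCountableTopology X := by
  have := h.sigmaFinite
  refine Metric.secondCountable_of_almost_dense_set fun ε hε => ?_
  obtain ⟨u, -, hu, hcov⟩ := Vitali.exists_disjoint_subfamily_covering_enlargement_closedBall
    (univ : Set X) id (fun _ => ε / 5) (ε / 5) (fun _ _ => le_rfl) 5 (by norm_num)
  refine ⟨u, ?_, fun x => ?_⟩
  · have hc := Measure.countable_meas_pos_of_disjoint_iUnion (μ := μ)
      (As := fun x : u => closedBall (x : X) (ε / 5)) (fun _ => measurableSet_closedBall)
      (fun a b hab => hu a.2 b.2 (fun hab' => hab (Subtype.ext hab')))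
    have huniv : {i : u | 0 < μ (closedBall (i : X) (ε / 5))} = univ :=
      eq_univ_of_forall fun i => (h.ball_pos i (ε / 5) (by positivity)).trans_le
        (measure_mono ball_subset_closedBall)
    rw [huniv] at hc
    exact countable_coe_iff.1 (countable_univ_iff.1 hc)
  · obtain ⟨b, hb, hxb⟩ := hcov x (mem_univ x)
    refine ⟨b, hb, ?_⟩
    have := hxb (mem_closedBall_self (by positivity))
    simpa [mul_div_cancel₀] using this

theorem measure_ball_two_pow_mul_le (h : IsPIMeasure μ R β Λ τ) (x : X) (k : ℕ) {r : ℝ}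
    (hr : 0 < r) (hR : ENNReal.ofReal (2 ^ k * r) ≤ R) :
    μ (ball x (2 ^ k * r)) ≤ (β : ℝ≥0∞) ^ k * μ (ball x r) := by
  induction k with
  | zero => simp
  | succ k ih =>
    have hle : ENNReal.ofReal (2 ^ k * r) ≤ R := by
      refine (ENNReal.ofReal_le_ofReal ?_).trans hR
      gcongr <;> norm_num
    calc μ (ball x (2 ^ (k + 1) * r)) = μ (ball x (2 * (2 ^ k * r))) := by ring_nf
      _ ≤ β * μ (ball x (2 ^ k * r)) := h.doubling x _ (by positivity) hle
      _ ≤ β * (β ^ k * μ (ball x r)) := by gcongr; exact ih hle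
      _ = β ^ (k + 1) * μ (ball x r) := by ring

theorem isUnifLocDoublingMeasure (h : IsPIMeasure μ R β Λ τ) (hR : 0 < R) :
    IsUnifLocDoublingMeasure μ := by
  -- Two doublings, because the closed ball of radius 2ε is compared with the open ball of radius
  -- 4ε.
  refine ⟨β ^ 2, ?_⟩
  obtain ⟨ρ, -, hρ0, hρR⟩ : ∃ ρ : ℝ, True ∧ 0 < ρ ∧ ENNReal.ofReal ρ ≤ R := by
    obtain ⟨ρ, hρ0, hρ⟩ := ENNReal.lt_iff_exists_nnreal_btwn.1 hR
    exact ⟨ρ, trivial, by exact_mod_cast hρ0, by simpa using hρ.le⟩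
  filter_upwards [Ioo_mem_nhdsGT (show (0 : ℝ) < ρ / 4 by positivity)] with ε hε x
  calc μ (closedBall x (2 * ε)) ≤ μ (ball x (2 ^ 2 * ε)) :=
        measure_mono (closedBall_subset_ball (by linarith [hε.1]))
    _ ≤ (β : ℝ≥0∞) ^ 2 * μ (ball x ε) :=
        h.measure_ball_two_pow_mul_le x 2 hε.1
          ((ENNReal.ofReal_le_ofReal (by linarith [hε.2])).trans hρR)
    _ ≤ ↑(β ^ 2) * μ (closedBall x ε) := by
        push_cast; gcongr; exact ball_subset_closedBall

end IsPIMeasure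

/-! ### Measurability of maps into `L¹` -/

/-- An open set is a countable union of balls. For L¹-valued maps distances are integrals, whose
measurability comes from Tonelli. -/
theorem measurable_of_measurable_edist {α E : Type*} [MeasurableSpace α] [PseudoEMetricSpace E]
    [SecondCountableTopology E] [MeasurableSpace E] [BorelSpace E] {g : α → E}
    (hg : ∀ v, Measurable fun y => edist (g y) v) : Measurable g := by
  refine measurable_of_isOpen fun s hs => ?_
  choose r hr hrs using fun x : s => EMetric.isOpen_iff.1 hs x x.2
  obtain ⟨T, hT, hTs⟩ := TopologicalSpace.isOpen_iUnion_countable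
    (fun x : s => Metric.eball (x : E) (r x)) (fun _ => Metric.isOpen_eball)
  have hunion : (⋃ x : s, Metric.eball (x : E) (r x)) = s := by
    refine Subset.antisymm (iUnion_subset hrs) fun x hx => ?_
    exact mem_iUnion.2 ⟨⟨x, hx⟩, Metric.mem_eball_self (hr _)⟩
  rw [← hunion, ← hTs, preimage_iUnion₂]
  exact MeasurableSet.biUnion hT fun x _ => measurableSet_lt (hg x) measurable_const

section Transpose

variable {α Y : Type*} [MeasurableSpace α] [MeasurableSpace Y] {μ : Measure α} {ν : Measure Y}

theorem enorm_Lp_one {u : Lp ℝ 1 ν} : ‖u‖ₑ = ∫⁻ y, ‖u y‖ₑ ∂ν := by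
  rw [Lp.enorm_def, eLpNorm_one_eq_lintegral_enorm]

theorem edist_Lp_one {u v : Lp ℝ 1 ν} : edist u v = ∫⁻ y, ‖u y - v y‖ₑ ∂ν := by
  rw [Lp.edist_def, eLpNorm_one_eq_lintegral_enorm]; rfl

theorem edist_Lp_one_of_ae_eq {u v : Lp ℝ 1 ν} {u' v' : Y → ℝ} (hu : u' =ᵐ[ν] u) (hv : v' =ᵐ[ν] v) :
    edist u v = ∫⁻ y, ‖u' y - v' y‖ₑ ∂ν := by
  rw [edist_Lp_one]
  refine lintegral_congr_ae ?_
  filter_upwards [hu, hv] with y h1 h2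
  rw [h1, h2]

open Classical in
theorem measurable_dite_toLp [SFinite μ] [SecondCountableTopology (Lp ℝ 1 μ)] {H : α × Y → ℝ}
    (hH : Measurable H) :
    Measurable fun y => if h : MemLp (fun x => H (x, y)) 1 μ then h.toLp else 0 := by
  refine measurable_of_measurable_edist fun v => ?_
  have hv : Measurable v := (Lp.stronglyMeasurable v).measurable
  have hHs : Measurable fun p : Y × α => H (p.2, p.1) := hH.comp measurable_swap
  have h1 : Measurable fun y => ∫⁻ x, ‖H (x, y)‖ₑ ∂μ := hHs.enorm.lintegral_prod_right'
  have h2 : Measurable fun y => ∫⁻ x, ‖H (x, y) - v x‖ₑ ∂μ :=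
    (hHs.sub (hv.comp measurable_snd)).enorm.lintegral_prod_right'
  have hset : MeasurableSet {y | ∫⁻ x, ‖H (x, y)‖ₑ ∂μ < ∞} := measurableSet_lt h1 measurable_const
  have hiff : ∀ y, MemLp (fun x => H (x, y)) 1 μ ↔ ∫⁻ x, ‖H (x, y)‖ₑ ∂μ < ∞ := fun y => by
    rw [memLp_one_iff_integrable, Integrable, HasFiniteIntegral]
    exact and_iff_right (hH.comp (measurable_id.prodMk measurable_const)).aestronglyMeasurable
  have h3 : Measurable fun y => if ∫⁻ x, ‖H (x, y)‖ₑ ∂μ < ∞ then ∫⁻ x, ‖H (x, y) - v x‖ₑ ∂μ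
      else edist (0 : Lp ℝ 1 μ) v := Measurable.ite hset h2 measurable_const
  convert h3 using 1
  funext y
  by_cases hy : MemLp (fun x => H (x, y)) 1 μ
  · rw [dif_pos hy, if_pos ((hiff y).1 hy), edist_Lp_one_of_ae_eq hy.coeFn_toLp.symm EventuallyEq.rfl]
  · rw [dif_neg hy, if_neg (fun h => hy ((hiff y).2 h))]

/-- Clear for simple maps, and stable under L¹ limits because passing from `f` to `H` is isometric
for the L¹ norms. -/
theorem exists_jointFunction [SFinite μ] [SFinite ν] {f : α → Lp ℝ 1 ν} (hf : MemLp f 1 μ) :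
    ∃ H : α × Y → ℝ, Integrable H (μ.prod ν) ∧ ∀ᵐ x ∂μ, (fun y => H (x, y)) =ᵐ[ν] f x := by
  refine MemLp.induction ENNReal.one_ne_top (fun f : α → Lp ℝ 1 ν => ∃ H : α × Y → ℝ,
    Integrable H (μ.prod ν) ∧ ∀ᵐ x ∂μ, (fun y => H (x, y)) =ᵐ[ν] f x) ?_ ?_ ?_ ?_ hf
  · intro c s hs hμs
    refine ⟨fun p => s.indicator 1 p.1 * c p.2,
      ((integrable_indicator_iff hs).2 (integrableOn_const hμs.ne)).mul_prod (L1.integrable_coeFn c),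
      Eventually.of_forall fun x => ?_⟩
    by_cases hx : x ∈ s
    · simp [hx]
    · simp only [indicator_of_notMem hx, zero_mul]
      exact (Lp.coeFn_zero ℝ 1 ν).symm
  · rintro f g - hf hg ⟨F, hF, hFf⟩ ⟨G, hG, hGg⟩
    refine ⟨F + G, hF.add hG, ?_⟩
    filter_upwards [hFf, hGg] with x h1 h2
    filter_upwards [h1, h2, Lp.coeFn_add (f x) (g x)] with y h3 h4 h5
    rw [Pi.add_apply, Pi.add_apply, h5, Pi.add_apply, h3, h4]
  · refine IsSeqClosed.isClosed fun f f₀ hf hlim => ?_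
    choose H hH hHf using hf
    have hdist : ∀ n m, edist ((hH n).toL1) ((hH m).toL1) = edist (f n) (f m) := by
      intro n m
      rw [Integrable.toL1, Integrable.toL1, Lp.edist_toLp_toLp, eLpNorm_one_eq_lintegral_enorm,
        lintegral_prod _ ((hH n).sub (hH m)).aestronglyMeasurable.enorm, Lp.edist_def,
        eLpNorm_one_eq_lintegral_enorm]
      refine lintegral_congr_ae ?_
      filter_upwards [hHf n, hHf m] with x h1 h2
      rw [Pi.sub_apply, ← edist_eq_enorm_sub, edist_Lp_one_of_ae_eq h1 h2]
      rfl
    have hcau : CauchySeq fun n => (hH n).toL1 := by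
      have := hlim.cauchySeq
      rw [EMetric.cauchySeq_iff] at this ⊢
      simpa only [hdist] using this
    obtain ⟨h, hh⟩ := cauchySeq_tendsto_of_complete hcau
    have hhi : Integrable h (μ.prod ν) := L1.integrable_coeFn h
    refine ⟨h, hhi, ?_⟩
    -- `G n x` bounds the L¹ distance from h (x, ·) to f₀ x by the triangle inequality, and its
    -- integral tends to 0. Fatou makes its lower limit vanish for almost every x, with no passage
    -- to a subsequence.
    let G : ℕ → α → ℝ≥0∞ := fun n x => ∫⁻ y, ‖h (x, y) - H n (x, y)‖ₑ ∂ν + ‖f n x - f₀ x‖ₑ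
    have hG1 : ∀ n, AEMeasurable (fun x => ∫⁻ y, ‖h (x, y) - H n (x, y)‖ₑ ∂ν) μ := fun n =>
      ((hhi.sub (hH n)).aestronglyMeasurable.enorm).lintegral_prod_right'
    have hG2 : ∀ n, AEMeasurable (fun x => ‖f n x - f₀ x‖ₑ) μ := fun n =>
      ((Lp.aestronglyMeasurable (f n)).sub (Lp.aestronglyMeasurable f₀)).enorm
    have hGint : ∀ n, ∫⁻ x, G n x ∂μ = edist h ((hH n).toL1) + edist (f n) f₀ := by
      intro n
      rw [lintegral_add_left' (hG1 n)]
      congr 1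
      · have hprod := lintegral_prod (fun p => ‖h p - H n p‖ₑ)
          (hhi.sub (hH n)).aestronglyMeasurable.enorm
        rw [Lp.edist_def, eLpNorm_one_eq_lintegral_enorm, ← hprod]
        refine lintegral_congr_ae ?_
        filter_upwards [(hH n).coeFn_toL1] with p hp
        rw [Pi.sub_apply, hp]
      · rw [Lp.edist_def, eLpNorm_one_eq_lintegral_enorm]; rfl
    have hlimG : Tendsto (fun n => ∫⁻ x, G n x ∂μ) atTop (𝓝 0) := by
      simp only [hGint]
      have h1 := (tendsto_iff_edist_tendsto_0.1 hh)
      have h2 := (tendsto_iff_edist_tendsto_0.1 hlim)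
      simpa [edist_comm] using h1.add h2
    have hGm : ∀ n, AEMeasurable (G n) μ := fun n => (hG1 n).add (hG2 n)
    have hlim0 : ∫⁻ x, liminf (fun n => (hGm n).mk (G n) x) atTop ∂μ = 0 := by
      refine le_antisymm ((lintegral_liminf_le fun n => (hGm n).measurable_mk).trans ?_) zero_le
      simp only [← lintegral_congr_ae (hGm _).ae_eq_mk]
      exact hlimG.liminf_eq.le
    rw [lintegral_eq_zero_iff (Measurable.liminf fun n => (hGm n).measurable_mk)] at hlim0
    filter_upwards [hlim0, ae_all_iff.2 fun n => (hGm n).ae_eq_mk, ae_all_iff.2 hHf,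
      hhi.prod_right_ae] with x hx hxG hxf hxi
    have hD : ∫⁻ y, ‖h (x, y) - f₀ x y‖ₑ ∂ν = 0 := by
      refine le_antisymm ?_ zero_le
      have hx0 : liminf (fun n => G n x) atTop = 0 := by
        simpa only [hxG, Pi.zero_apply] using hx
      rw [← hx0]
      refine le_liminf_of_le (by isBoundedDefault) (Eventually.of_forall fun n => ?_)
      calc ∫⁻ y, ‖h (x, y) - f₀ x y‖ₑ ∂ν
          ≤ ∫⁻ y, (‖h (x, y) - H n (x, y)‖ₑ + ‖H n (x, y) - f₀ x y‖ₑ) ∂ν := by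
            refine lintegral_mono fun y => ?_
            rw [← sub_add_sub_cancel (h (x, y)) (H n (x, y)) (f₀ x y)]
            exact enorm_add_le _ _
        _ = G n x := by
            have hHx : AEStronglyMeasurable (fun y => H n (x, y)) ν :=
              (Lp.aestronglyMeasurable (f n x)).congr (hxf n).symm
            have hm : AEMeasurable (fun y => ‖h (x, y) - H n (x, y)‖ₑ) ν :=
              (hxi.aestronglyMeasurable.sub hHx).enorm
            rw [lintegral_add_left' hm, ← edist_Lp_one_of_ae_eq (hxf n) EventuallyEq.rfl,
              edist_eq_enorm_sub]
    have hm : AEMeasurable (fun y => ‖h (x, y) - f₀ x y‖ₑ) ν :=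
      (hxi.aestronglyMeasurable.sub (Lp.aestronglyMeasurable _)).enorm
    rw [lintegral_eq_zero_iff' hm] at hD
    filter_upwards [hD] with y hy
    exact sub_eq_zero.1 (enorm_eq_zero.1 hy)
  · rintro f g hfg - ⟨H, hH, hHf⟩
    refine ⟨H, hH, ?_⟩
    filter_upwards [hfg, hHf] with x h1 h2
    rwa [← h1]

theorem jointFunction_spec [SFinite μ] [SFinite ν] {f : α → Lp ℝ 1 ν} (hf : MemLp f 1 μ) :
    Integrable (jointFunction μ ν f) (μ.prod ν) ∧
      ∀ᵐ x ∂μ, (fun y => jointFunction μ ν f (x, y)) =ᵐ[ν] f x := by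
  have h := exists_jointFunction hf
  rw [jointFunction, dif_pos h]
  exact h.choose_spec

theorem ae_transpose_eq [SFinite μ] [SFinite ν] {f : α → Lp ℝ 1 ν} (hf : MemLp f 1 μ) :
    ∀ᵐ y ∂ν, transpose μ ν f y =ᵐ[μ] fun x => jointFunction μ ν f (x, y) := by
  filter_upwards [(jointFunction_spec hf).1.prod_left_ae] with y hy
  rw [transpose, dif_pos (memLp_one_iff_integrable.2 hy)]
  exact MemLp.coeFn_toLp _

/-- `jointFunction` is only almost everywhere equal to a measurable function; by Fubini, for almost
every y the two agree almost everywhere on the slice and so define the same element of L¹. -/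
theorem aemeasurable_transpose [SFinite μ] [SFinite ν] [SecondCountableTopology (Lp ℝ 1 μ)]
    {f : α → Lp ℝ 1 ν} (hf : MemLp f 1 μ) : AEMeasurable (transpose μ ν f) ν := by
  classical
  obtain ⟨hH, -⟩ := jointFunction_spec hf
  obtain ⟨H, hHm, hHe⟩ := hH.aestronglyMeasurable
  refine ⟨_, measurable_dite_toLp (μ := μ) hHm.measurable, ?_⟩
  have hswap : ∀ᵐ p ∂ν.prod μ, jointFunction μ ν f p.swap = H p.swap :=
    (Measure.measurePreserving_swap (μ := ν) (ν := μ)).quasiMeasurePreserving.ae hHe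
  filter_upwards [Measure.ae_ae_of_ae_prod hswap, hH.prod_left_ae] with y hy hyi
  have hy' : (fun x => jointFunction μ ν f (x, y)) =ᵐ[μ] fun x => H (x, y) := hy
  have hm := memLp_one_iff_integrable.2 hyi
  rw [transpose, dif_pos hm, dif_pos (hm.ae_eq hy')]
  exact MemLp.toLp_congr _ _ hy'

end Transpose

/-! ### Slices -/

section Slice

variable {α : Type*} [MeasurableSpace α] {μ : Measure α}

/-- The characteristic function of `sliceSet u t`, as a function of the value of `u`. -/
noncomputable def sliceInd (t a : ℝ) : ℝ := if (0 < t ∧ t ≤ a) ∨ (t < 0 ∧ a ≤ t) then 1 else 0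

theorem slice_coe_ae_eq (u : Lp ℝ 1 μ) (t : ℝ) :
    (slice (u, t)).1 =ᵐ[μ] fun x => sliceInd t (u x) := by
  have h := indicatorConstLp_coeFn (p := 1) (c := (1 : ℝ))
    (hs := measurableSet_sliceSet (Lp.stronglyMeasurable u).measurable t)
    (hμs := measure_sliceSet_ne_top (Lp.memLp u) t)
  filter_upwards [h] with x hx
  refine hx.trans ?_
  simp only [indicator, sliceSet, mem_ofPred_eq, sliceInd]
  congr

/-- Layer cake: apart from t = 0, a, b, the integrand is the indicator of the interval between a and
b. Negative levels, where the slice is a sublevel set, only change the sign inside the norm. -/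
theorem lintegral_enorm_sliceInd_sub (a b : ℝ) :
    ∫⁻ t, ‖sliceInd t a - sliceInd t b‖ₑ = ‖a - b‖ₑ := by
  wlog hab : a ≤ b generalizing a b
  · simpa only [enorm_sub_rev] using this b a (le_of_not_ge hab)
  rw [enorm_sub_rev, Real.enorm_of_nonneg (sub_nonneg.2 hab), ← Real.volume_Ioc,
    ← lintegral_indicator_one measurableSet_Ioc]
  refine lintegral_congr_ae ?_
  filter_upwards [Measure.ae_ne volume 0, Measure.ae_ne volume a, Measure.ae_ne volume b]
    with t h0 ha hb
  simp only [sliceInd, indicator, mem_Ioc, Pi.one_apply]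
  rcases lt_or_gt_of_ne h0 with h | h <;> rcases lt_or_gt_of_ne ha with h' | h' <;>
    rcases lt_or_gt_of_ne hb with h'' | h'' <;>
    simp [h, h.not_gt, h'.le, h'.not_ge, h''.le, h''.not_ge, h'.not_gt, h'] <;> linarith

theorem measurable_sliceInd : Measurable fun p : ℝ × ℝ => sliceInd p.1 p.2 := by
  refine Measurable.ite (p := fun p : ℝ × ℝ =>
    (0 < p.1 ∧ p.1 ≤ p.2) ∨ (p.1 < 0 ∧ p.2 ≤ p.1)) ?_ measurable_const
    measurable_const
  exact ((measurableSet_lt measurable_const measurable_fst).inter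
    (measurableSet_le measurable_fst measurable_snd)).union
    ((measurableSet_lt measurable_fst measurable_const).inter
    (measurableSet_le measurable_snd measurable_fst))

/-- Scaling reduces joint measurability of `slice` to the single level 1. At t = 0 the convention
0⁻¹ = 0 gives the empty slice, as it should. -/
theorem sliceInd_eq_one_inv_mul (t a : ℝ) : sliceInd t a = sliceInd 1 (t⁻¹ * a) := by
  rcases lt_trichotomy t 0 with h | rfl | h
  · have : 1 ≤ t⁻¹ * a ↔ a ≤ t := by rw [inv_mul_eq_div, one_le_div_of_neg h]
    simp [sliceInd, h, h.not_gt, this, zero_le_one.not_gt]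
  · simp [sliceInd, zero_le_one.not_gt]
  · have : 1 ≤ t⁻¹ * a ↔ t ≤ a := by rw [inv_mul_eq_div, one_le_div h]
    simp [sliceInd, h, h.not_gt, this, zero_le_one.not_gt]

/-- A `(n + 1)`-Lipschitz approximation of the characteristic function of `[1, ∞)`. -/
noncomputable def unitRamp (n : ℕ) (a : ℝ) : ℝ := max 0 (min 1 ((n + 1) * (a - 1) + 1))

theorem lipschitzWith_unitRamp (n : ℕ) : LipschitzWith (n + 1) (unitRamp n) := by
  have h : LipschitzWith (n + 1) fun a : ℝ => ((n : ℝ) + 1) * (a - 1) + 1 := by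
    refine LipschitzWith.of_dist_le_mul fun a b => ?_
    rw [Real.dist_eq, Real.dist_eq]
    rw [show ((n : ℝ) + 1) * (a - 1) + 1 - (((n : ℝ) + 1) * (b - 1) + 1) = (n + 1) * (a - b) by ring,
      abs_mul, abs_of_nonneg (by positivity : (0 : ℝ) ≤ n + 1)]
    simp
  exact (h.const_min 1).const_max 0

theorem unitRamp_zero (n : ℕ) : unitRamp n 0 = 0 := by
  rw [unitRamp]
  refine max_eq_left ((min_le_right _ _).trans ?_)
  have : (0 : ℝ) ≤ n := n.cast_nonneg
  linarith

/-- The domination needed on a space of possibly infinite measure. For a < 1 the sloped part of the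
ramp is a + n(a - 1), which is at most a. -/
theorem enorm_unitRamp_sub_le (n : ℕ) (a : ℝ) : ‖unitRamp n a - sliceInd 1 a‖ₑ ≤ ‖a‖ₑ := by
  rw [Real.enorm_eq_ofReal_abs, Real.enorm_eq_ofReal_abs]
  refine ENNReal.ofReal_le_ofReal ?_
  have hn : (0 : ℝ) ≤ n := n.cast_nonneg
  rcases le_or_gt 1 a with h | h
  · have h1 : (1 : ℝ) ≤ (n + 1) * (a - 1) + 1 := by nlinarith
    simp [unitRamp, sliceInd, h, h1]
  · have h1 : ((n : ℝ) + 1) * (a - 1) + 1 ≤ a := by nlinarith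
    simp only [unitRamp, sliceInd, h.not_ge, and_false, zero_le_one.not_gt, false_and, or_self,
      if_false, sub_zero]
    rw [abs_of_nonneg (le_max_left _ _)]
    exact max_le (abs_nonneg _) ((min_le_right _ _).trans (h1.trans (le_abs_self a)))

theorem tendsto_unitRamp (a : ℝ) :
    Tendsto (fun n => ‖unitRamp n a - sliceInd 1 a‖ₑ) atTop (𝓝 0) := by
  refine tendsto_const_nhds.congr' ?_
  rcases le_or_gt 1 a with h | h
  · refine Eventually.of_forall fun n => ?_
    have hn : (0 : ℝ) ≤ n := n.cast_nonneg
    have h1 : (1 : ℝ) ≤ (n + 1) * (a - 1) + 1 := by nlinarith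
    simp [unitRamp, sliceInd, h, h1]
  · obtain ⟨N, hN⟩ := exists_nat_gt (1 - a)⁻¹
    filter_upwards [eventually_ge_atTop N] with n hn
    have hnN : (1 - a)⁻¹ ≤ n := hN.le.trans (by exact_mod_cast hn)
    have h1 : 1 ≤ (n : ℝ) * (1 - a) := by
      rwa [inv_le_iff_one_le_mul₀ (by linarith)] at hnN
    have h2 : ((n : ℝ) + 1) * (a - 1) + 1 ≤ 0 := by nlinarith
    simp [unitRamp, sliceInd, h.not_ge, zero_le_one.not_gt, h2]

theorem measurable_slice_one [SecondCountableTopology (Lp ℝ 1 μ)] :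
    Measurable fun u : Lp ℝ 1 μ => (slice (u, 1)).1 := by
  refine measurable_of_tendsto_metrizable
    (f := fun n => (lipschitzWith_unitRamp n).compLp (unitRamp_zero n)) (fun n =>
      ((lipschitzWith_unitRamp n).continuous_compLp (unitRamp_zero n)).measurable) ?_
  rw [tendsto_pi_nhds]
  intro u
  rw [tendsto_iff_edist_tendsto_0]
  have hum : Measurable u := (Lp.stronglyMeasurable u).measurable
  have hedist : ∀ n, edist ((lipschitzWith_unitRamp n).compLp (unitRamp_zero n) u) (slice (u, 1)).1
      = ∫⁻ x, ‖unitRamp n (u x) - sliceInd 1 (u x)‖ₑ ∂μ := fun n =>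
    edist_Lp_one_of_ae_eq ((lipschitzWith_unitRamp n).coeFn_compLp (unitRamp_zero n) u).symm
      (slice_coe_ae_eq u 1).symm
  simp only [hedist]
  rw [← lintegral_zero (μ := μ)]
  refine tendsto_lintegral_of_dominated_convergence (fun x => ‖u x‖ₑ) (fun n => ?_)
    (fun n => Eventually.of_forall fun x => enorm_unitRamp_sub_le n (u x)) ?_
    (Eventually.of_forall fun x => tendsto_unitRamp (u x))
  · exact (((lipschitzWith_unitRamp n).continuous.measurable.comp hum).sub
      (measurable_sliceInd.comp (measurable_const.prodMk hum))).enorm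
  · rw [← enorm_Lp_one]; exact enorm_ne_top

theorem measurable_slice [SecondCountableTopology (Lp ℝ 1 μ)] :
    Measurable (slice : Lp ℝ 1 μ × ℝ → Cut μ) := by
  refine Measurable.subtype_mk ?_
  have h : (fun q : Lp ℝ 1 μ × ℝ => (slice q).1) = fun q => (slice (q.2⁻¹ • q.1, 1)).1 := by
    funext q
    refine Lp.ext ?_
    filter_upwards [slice_coe_ae_eq q.1 q.2, slice_coe_ae_eq (q.2⁻¹ • q.1) 1,
      Lp.coeFn_smul q.2⁻¹ q.1] with x h1 h2 h3
    rw [h2, h3, Pi.smul_apply, smul_eq_mul, ← sliceInd_eq_one_inv_mul, ← h1]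
  change Measurable (fun q : Lp ℝ 1 μ × ℝ => (slice q).1)
  rw [h]
  exact measurable_slice_one.comp ((measurable_snd.inv).smul measurable_fst)

end Slice

/-! ### Integrals against the cut measure -/

section

variable {α Y : Type*} [MeasurableSpace α] [MeasurableSpace Y] {μ : Measure α} {ν : Measure Y}

theorem exists_measurable_jointFunction [SFinite μ] [SFinite ν] {f : α → Lp ℝ 1 ν}
    (hf : MemLp f 1 μ) : ∃ H : α × Y → ℝ, Measurable H ∧ Integrable H (μ.prod ν) ∧
      (∀ᵐ x ∂μ, (fun y => H (x, y)) =ᵐ[ν] f x) ∧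
      ∀ᵐ y ∂ν, transpose μ ν f y =ᵐ[μ] fun x => H (x, y) := by
  obtain ⟨hi, hfi⟩ := jointFunction_spec hf
  obtain ⟨H, hHm, hHe⟩ := id hi.aestronglyMeasurable
  refine ⟨H, hHm.measurable, hi.congr hHe, ?_, ?_⟩
  · filter_upwards [hfi, Measure.ae_ae_of_ae_prod hHe] with x h1 h2
    exact EventuallyEq.trans (EventuallyEq.symm h2) h1
  · have hswap : ∀ᵐ p ∂ν.prod μ, jointFunction μ ν f p.swap = H p.swap :=
      (Measure.measurePreserving_swap (μ := ν) (ν := μ)).quasiMeasurePreserving.ae hHe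
    filter_upwards [ae_transpose_eq hf, Measure.ae_ae_of_ae_prod hswap] with y h1 h2
    exact h1.trans h2

theorem doubleOsc_congr {V : Type*} [NormedAddCommGroup V] {B : Set α} {u v : α → V}
    (h : u =ᵐ[μ.restrict B] v) : doubleOsc μ B u = doubleOsc μ B v := by
  refine lintegral_congr_ae ?_
  filter_upwards [h] with z hz
  refine lintegral_congr_ae ?_
  filter_upwards [h] with w hw
  rw [hz, hw]

theorem lintegral_doubleOsc [SFinite μ] [SFinite ν] {G : Y → α → ℝ} (B : Set α)
    (hG : Measurable (Function.uncurry G)) :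
    ∫⁻ y, doubleOsc μ B (G y) ∂ν
      = ∫⁻ z in B, ∫⁻ w in B, ∫⁻ y, ‖G y z - G y w‖ₑ ∂ν ∂μ ∂μ := by
  have hm : Measurable fun p : (Y × α) × α => ‖G p.1.1 p.1.2 - G p.1.1 p.2‖ₑ :=
    ((hG.comp measurable_fst).sub
      (hG.comp ((measurable_fst.comp measurable_fst).prodMk measurable_snd))).enorm
  simp only [doubleOsc]
  rw [lintegral_lintegral_swap (hm.lintegral_prod_right').aemeasurable]
  refine lintegral_congr fun z => ?_
  rw [lintegral_lintegral_swap]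
  exact (hm.comp ((measurable_fst.prodMk measurable_const).prodMk measurable_snd)).aemeasurable

theorem lintegral_doubleOsc_slice [SFinite μ] {B U : Set α} (hB : B ⊆ U)
    (u : Lp ℝ 1 (μ.restrict U)) :
    ∫⁻ t, doubleOsc μ B (slice (u, t)).1 = doubleOsc μ B u := by
  have hu : Measurable u := (Lp.stronglyMeasurable u).measurable
  have h : ∀ t, doubleOsc μ B (slice (u, t)).1 = doubleOsc μ B (fun x => sliceInd t (u x)) :=
    fun t => doubleOsc_congr (ae_restrict_of_ae_restrict_of_subset hB (slice_coe_ae_eq u t))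
  simp only [h]
  rw [lintegral_doubleOsc B (G := fun t x => sliceInd t (u x))]
  · simp only [lintegral_enorm_sliceInd_sub]; rfl
  · exact measurable_sliceInd.comp (measurable_fst.prodMk (hu.comp measurable_snd))

theorem continuous_doubleOsc {B U : Set α} (hB : B ⊆ U) (hμB : μ B ≠ ∞) :
    Continuous fun u : Lp ℝ 1 (μ.restrict U) => doubleOsc μ B u := by
  refine continuous_of_le_add_edist (2 * μ B) (ENNReal.mul_ne_top (by simp) hμB) fun u v => ?_
  have hBU := Measure.restrict_mono hB (le_refl μ)
  refine (doubleOsc_le_add (v := v) (((Lp.aestronglyMeasurable u).sub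
    (Lp.aestronglyMeasurable v)).mono_measure hBU)).trans ?_
  rw [edist_Lp_one]
  gcongr

theorem lintegral_cutMeasure [SFinite μ] [SFinite ν] [SecondCountableTopology (Lp ℝ 1 μ)]
    {f : α → Lp ℝ 1 ν} (hf : MemLp f 1 μ) {P : Cut μ → ℝ≥0∞} (hP : Measurable P) :
    ∫⁻ E, P E ∂cutMeasure μ ν f = ∫⁻ y, (∫⁻ t : ℝ, P (slice (transpose μ ν f y, t))) ∂ν := by
  have : SFinite (tautMeasure μ ν f) := by rw [tautMeasure]; infer_instance
  have hPs : Measurable fun q : Lp ℝ 1 μ × ℝ => P (slice q) := hP.comp measurable_slice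
  rw [cutMeasure, lintegral_map hP measurable_slice, lintegral_prod _ hPs.aemeasurable, tautMeasure]
  exact lintegral_map' hPs.lintegral_prod_right'.aemeasurable (aemeasurable_transpose hf)

/-- For arbitrary `P` and `f`: the change of variables and Tonelli persist as inequalities in this
direction. This allows `P` to be the perimeter. -/
theorem lintegral_cutMeasure_le (f : α → Lp ℝ 1 ν) (P : Cut μ → ℝ≥0∞) :
    ∫⁻ E, P E ∂cutMeasure μ ν f ≤ ∫⁻ y, (∫⁻ t : ℝ, P (slice (transpose μ ν f y, t))) ∂ν :=
  (lintegral_map_le _ _).trans ((lintegral_prod_le _).trans (lintegral_map_le _ _))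

/-- Integrating the layer-cake identity over levels gives the oscillation of H(·, y), and
integrating over y gives the L¹(Y) norm of f z - f w. -/
theorem lintegral_doubleOsc_cutMeasure [SFinite μ] [SFinite ν] {B U : Set α} (hB : B ⊆ U)
    (hμB : μ B ≠ ∞) [SecondCountableTopology (Lp ℝ 1 (μ.restrict U))]
    {f : α → Lp ℝ 1 ν} (hf : MemLp f 1 (μ.restrict U)) :
    ∫⁻ E, doubleOsc μ B E.1 ∂cutMeasure (μ.restrict U) ν f = doubleOsc μ B f := by
  have hP : Measurable fun E : Cut (μ.restrict U) => doubleOsc μ B E.1 :=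
    (continuous_doubleOsc hB hμB).measurable.comp measurable_subtype_coe
  rw [lintegral_cutMeasure hf hP]
  simp only [lintegral_doubleOsc_slice hB]
  obtain ⟨H, hHm, -, hHf, hHt⟩ := exists_measurable_jointFunction hf
  have h1 : ∫⁻ y, doubleOsc μ B (transpose (μ.restrict U) ν f y) ∂ν
      = ∫⁻ y, doubleOsc μ B (fun x => H (x, y)) ∂ν := by
    refine lintegral_congr_ae ?_
    filter_upwards [hHt] with y hy
    exact doubleOsc_congr (ae_restrict_of_ae_restrict_of_subset hB hy)
  rw [h1, lintegral_doubleOsc B (G := fun y x => H (x, y)) (hHm.comp measurable_swap)]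
  have hHB := ae_restrict_of_ae_restrict_of_subset hB hHf
  refine lintegral_congr_ae ?_
  filter_upwards [hHB] with z hz
  refine lintegral_congr_ae ?_
  filter_upwards [hHB] with w hw
  rw [← edist_eq_enorm_sub, edist_Lp_one_of_ae_eq hz hw]

end

/-! ### The Poincaré inequality with the total perimeter -/

section

variable {X Y : Type*} [MetricSpace X] [MeasurableSpace X] [BorelSpace X] [MeasurableSpace Y]
  {μ : Measure X} {ν : Measure Y} {R : ℝ≥0∞} {β Λ τ : ℝ≥0}

/-- The oscillation of `f` is the integral of the oscillations of its cuts, and the BV Poincaré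
inequality bounds each of these by its perimeter. -/
theorem IsPIMeasure.doubleOsc_le_totalPerimeter [SFinite ν] (h : IsPIMeasure μ R β Λ τ)
    (hΛ : 1 ≤ Λ) {U : Set X} {f : X → Lp ℝ 1 ν} (hf : MemLp f 1 (μ.restrict U)) {x : X} {s : ℝ}
    (hs : 0 < s) (hsR : ENNReal.ofReal s ≤ R) {W : Set X} (hW : IsOpen W)
    (hxW : closedBall x (Λ * s) ⊆ W) (hWU : W ⊆ U) :
    doubleOsc μ (ball x s) f ≤ 2 * μ (ball x s) * (ENNReal.ofReal s * (τ + 1)) *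
      totalPerimeter μ U (cutMeasure (μ.restrict U) ν f) W := by
  have := h.sigmaFinite
  have := h.secondCountableTopology
  have : Fact ((1 : ℝ≥0∞) ≠ ∞) := ⟨ENNReal.one_ne_top⟩
  have hB : ball x s ⊆ W := (ball_subset_closedBall.trans (closedBall_subset_closedBall
      (le_mul_of_one_le_left hs.le (by exact_mod_cast hΛ)))).trans hxW
  have hKt : 2 * μ (ball x s) * (ENNReal.ofReal s * (τ + 1)) ≠ ⊤ :=
    ENNReal.mul_ne_top (ENNReal.mul_ne_top (by simp) (h.ball_lt_top x s).ne)
      (ENNReal.mul_ne_top (by simp) (by simp))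
  rw [← lintegral_doubleOsc_cutMeasure (hB.trans hWU) (h.ball_lt_top x s).ne hf, totalPerimeter,
    ← lintegral_const_mul' _ _ hKt]
  refine lintegral_mono fun E => ?_
  rw [perimeterMeasure_of_isOpen hW hWU]
  exact h.doubleOsc_le_variation hΛ hs hsR hW hxW
    (IntegrableOn.mono_set (L1.integrable_coeFn E.1) hWU)

end

/-! ### Maps with small mean oscillation have Lipschitz representatives -/

/-- Halving the scale s costs at most G s, then G s / 2, and so on; the geometric series sums to 2 G
s. A final scale between two dyadic ones is covered by the freedom of s' in the hypothesis. -/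
theorem exists_tendsto_of_dyadic {E : Type*} [NormedAddCommGroup E] [CompleteSpace E] {a : ℝ → E}
    {P : ℝ → Prop} {G : ℝ} (hG : 0 ≤ G) (hP : ∀ s s', 0 < s' → s' ≤ s → P s → P s')
    (hP0 : ∀ s, P s → 0 < s)
    (h : ∀ s s', P s → s / 2 ≤ s' → s' ≤ s → ‖a s' - a s‖ ≤ G * s) (hex : ∃ s, P s) :
    ∃ v, Tendsto a (𝓝[>] 0) (𝓝 v) ∧ ∀ s, P s → ‖v - a s‖ ≤ 2 * G * s := by
  have key : ∀ (n : ℕ) (s s' : ℝ), P s → s / 2 ^ n ≤ s' → s' ≤ s → ‖a s' - a s‖ ≤ 2 * G * s := by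
    intro n
    induction n with
    | zero =>
      intro s s' hs h1 h2
      obtain rfl : s' = s := le_antisymm h2 (by simpa using h1)
      have := hP0 _ hs
      simp only [sub_self, norm_zero]; positivity
    | succ n ih =>
      intro s s' hs h1 h2
      have hs0 := hP0 _ hs
      rcases le_or_gt (s / 2) s' with h3 | h3
      · refine (h s s' hs h3 h2).trans ?_
        nlinarith [mul_nonneg hG hs0.le]
      · have h4 := ih (s / 2) s' (hP s _ (by positivity) (by linarith) hs)
          (by rw [div_div, ← pow_succ']; exact h1) h3.le
        have h5 := h s (s / 2) hs le_rfl (by linarith)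
        calc ‖a s' - a s‖ ≤ ‖a s' - a (s / 2)‖ + ‖a (s / 2) - a s‖ := norm_sub_le_norm_sub_add_norm_sub ..
          _ ≤ 2 * G * (s / 2) + G * s := add_le_add h4 h5
          _ = 2 * G * s := by ring
  have key' : ∀ s s' : ℝ, P s → 0 < s' → s' ≤ s → ‖a s' - a s‖ ≤ 2 * G * s := by
    intro s s' hs h1 h2
    have hs0 := hP0 _ hs
    obtain ⟨n, hn⟩ := exists_pow_lt_of_lt_one (div_pos h1 hs0) (by norm_num : (1 / 2 : ℝ) < 1)
    refine key n s s' hs ?_ h2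
    rw [lt_div_iff₀ hs0, one_div, inv_pow, inv_mul_eq_div] at hn
    exact hn.le
  obtain ⟨s₀, hs₀⟩ := hex
  have hs₀0 := hP0 _ hs₀
  have hcau : Cauchy (map a (𝓝[>] 0)) := by
    rw [Metric.cauchy_iff]
    refine ⟨inferInstance, fun ε hε => ?_⟩
    obtain ⟨s, hs0, hss₀, hsε⟩ : ∃ s, 0 < s ∧ s ≤ s₀ ∧ 4 * G * s < ε := by
      refine ⟨min s₀ (ε / (4 * G + 1)), by positivity, min_le_left _ _, ?_⟩
      calc 4 * G * min s₀ (ε / (4 * G + 1)) ≤ 4 * G * (ε / (4 * G + 1)) := by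
            gcongr; exact min_le_right _ _
        _ < ε := by rw [← mul_div_assoc, div_lt_iff₀ (by positivity)]; nlinarith
    have hPs := hP s₀ s hs0 hss₀ hs₀
    refine ⟨a '' Ioc 0 s, image_mem_map (Ioc_mem_nhdsGT hs0), ?_⟩
    rintro - ⟨s₁, h1, rfl⟩ - ⟨s₂, h2, rfl⟩
    rw [dist_eq_norm]
    have h3 := key' s s₁ hPs h1.1 h1.2
    have h4 := key' s s₂ hPs h2.1 h2.2
    rw [norm_sub_rev] at h4
    linarith [norm_sub_le_norm_sub_add_norm_sub (a s₁) (a s) (a s₂)]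
  obtain ⟨v, hv⟩ := cauchy_map_iff_exists_tendsto.1 hcau
  refine ⟨v, hv, fun s hs => ?_⟩
  refine le_of_tendsto ((hv.sub_const (a s)).norm) ?_
  filter_upwards [Ioc_mem_nhdsGT (hP0 s hs)] with s' hs'
  exact key' s s' hs hs'.1 hs'.2

section Average

variable {X E : Type*} [MeasurableSpace X] [NormedAddCommGroup E] [NormedSpace ℝ E]
  [CompleteSpace E] {μ : Measure X}

theorem measure_mul_enorm_setAverage_sub_le {B : Set X} (hB : μ B ≠ ∞) {f : X → E}
    (hf : IntegrableOn f B μ) (c : E) :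
    μ B * ‖(⨍ z in B, f z ∂μ) - c‖ₑ ≤ ∫⁻ z in B, ‖f z - c‖ₑ ∂μ := by
  have h1 : μ.real B • ((⨍ z in B, f z ∂μ) - c) = ∫ z in B, (f z - c) ∂μ := by
    rw [smul_sub, measure_smul_setAverage _ hB, integral_sub hf (integrableOn_const hB),
      setIntegral_const]
  have h2 : ‖μ.real B • ((⨍ z in B, f z ∂μ) - c)‖ₑ = μ B * ‖(⨍ z in B, f z ∂μ) - c‖ₑ := by
    rw [enorm_smul, Real.enorm_of_nonneg measureReal_nonneg, ofReal_measureReal hB]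
  rw [← h2, h1]
  exact enorm_integral_le_lintegral_enorm _

theorem measure_mul_enorm_setAverage_sub_setAverage_le {B B' : Set X} (hB : μ B ≠ ∞) (hBB : B' ⊆ B)
    {f : X → E} (hf : IntegrableOn f B μ) :
    μ B * (μ B' * ‖(⨍ z in B', f z ∂μ) - ⨍ z in B, f z ∂μ‖ₑ) ≤ doubleOsc μ B f := by
  have hB' : μ B' ≠ ∞ := ne_top_of_le_ne_top hB (measure_mono hBB)
  calc μ B * (μ B' * ‖(⨍ z in B', f z ∂μ) - ⨍ z in B, f z ∂μ‖ₑ)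
      ≤ μ B * ∫⁻ z in B', ‖f z - ⨍ w in B, f w ∂μ‖ₑ ∂μ := by
        gcongr
        exact measure_mul_enorm_setAverage_sub_le hB' (hf.mono_set hBB) _
    _ = ∫⁻ z in B', μ B * ‖f z - ⨍ w in B, f w ∂μ‖ₑ ∂μ := (lintegral_const_mul' _ _ hB).symm
    _ ≤ ∫⁻ z in B', ∫⁻ w in B, ‖f z - f w‖ₑ ∂μ ∂μ := by
        refine lintegral_mono fun z => ?_
        simp only [enorm_sub_rev (f z)]
        exact measure_mul_enorm_setAverage_sub_le hB hf _
    _ ≤ doubleOsc μ B f := lintegral_mono_set hBB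

end Average

section Representative

variable {X E : Type*} [MetricSpace X] [MeasurableSpace X] [NormedAddCommGroup E]
  [NormedSpace ℝ E] [CompleteSpace E] {μ : Measure X} {R : ℝ≥0∞} {β Λ τ : ℝ≥0}

/-- Two doublings make μ(B') comparable to the measure of the large ball. `B'` need only lie between
two balls, so that it can be an open ball, or a closed one as in the differentiation theorem. -/
theorem IsPIMeasure.norm_setAverage_sub_setAverage_le (h : IsPIMeasure μ R β Λ τ) {x x' : X}
    {s s' : ℝ} (hs' : 0 < s') (hs'R : ENNReal.ofReal (4 * s') ≤ R)
    {B' : Set X} (h1 : ball x' s' ⊆ B') (h2 : B' ⊆ ball x s) (h3 : ball x s ⊆ ball x' (4 * s'))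
    {f : X → E} (hf : IntegrableOn f (ball x s) μ) {K : ℝ} (hK : 0 ≤ K)
    (hosc : doubleOsc μ (ball x s) f ≤ ENNReal.ofReal K * μ (ball x s) ^ 2) :
    ‖(⨍ z in B', f z ∂μ) - ⨍ z in ball x s, f z ∂μ‖ ≤ K * β ^ 2 := by
  have hB := (h.ball_lt_top x s).ne
  have hB' : μ B' ≠ ∞ := ne_top_of_le_ne_top hB (measure_mono h2)
  have hB'0 : μ B' ≠ 0 := ((h.ball_pos x' s' hs').trans_le (measure_mono h1)).ne'
  have hB0 : μ (ball x s) ≠ 0 := fun h0 => hB'0 (measure_mono_null h2 h0)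
  have hdoub : μ (ball x s) ≤ (β : ℝ≥0∞) ^ 2 * μ B' := by
    calc μ (ball x s) ≤ μ (ball x' (2 ^ 2 * s')) := measure_mono (by norm_num; exact h3)
      _ ≤ (β : ℝ≥0∞) ^ 2 * μ (ball x' s') :=
          h.measure_ball_two_pow_mul_le x' 2 hs' (by rwa [show (2 : ℝ) ^ 2 = 4 by norm_num])
      _ ≤ (β : ℝ≥0∞) ^ 2 * μ B' := by gcongr
  have h4 := (measure_mul_enorm_setAverage_sub_setAverage_le hB h2 hf).trans hosc
  have h5 : μ (ball x s) * (μ B' * ‖(⨍ z in B', f z ∂μ) - ⨍ z in ball x s, f z ∂μ‖ₑ)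
      ≤ μ (ball x s) * (μ B' * (ENNReal.ofReal K * β ^ 2)) := by
    refine h4.trans ?_
    calc ENNReal.ofReal K * μ (ball x s) ^ 2 = μ (ball x s) * (ENNReal.ofReal K * μ (ball x s)) := by
          ring
      _ ≤ μ (ball x s) * (ENNReal.ofReal K * ((β : ℝ≥0∞) ^ 2 * μ B')) := by gcongr
      _ = _ := by ring
  have h6 := (ENNReal.mul_le_mul_iff_right hB'0 hB').1 ((ENNReal.mul_le_mul_iff_right hB0 hB).1 h5)
  have h7 : ENNReal.ofReal K * β ^ 2 = ENNReal.ofReal (K * β ^ 2) := by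
    rw [ENNReal.ofReal_mul hK, ENNReal.ofReal_pow β.coe_nonneg, ENNReal.ofReal_coe_nnreal]
  rw [h7, ← ofReal_norm] at h6
  exact (ENNReal.ofReal_le_ofReal_iff (by positivity)).1 h6

variable [BorelSpace X]

/-- Campanato's argument: the averages of `f` over shrinking balls converge at every point of `U`
with an error linear in the radius. The limit is `f` almost everywhere by Lebesgue differentiation,
and at two points it is compared through balls of radius comparable to their distance. -/
theorem IsPIMeasure.exists_lipschitz_representative (h : IsPIMeasure μ R β Λ τ) (hR : 0 < R)
    {U : Set X} (hU : IsOpen U) {f : X → E} (hf : IntegrableOn f U μ) {N M : ℝ} (hN : 4 ≤ N)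
    (hM : 0 ≤ M)
    (hosc : ∀ x s, 0 < s → ENNReal.ofReal (N * s) ≤ R → ball x (N * s) ⊆ U →
      doubleOsc μ (ball x s) f ≤ ENNReal.ofReal (M * s) * μ (ball x s) ^ 2) :
    ∃ F : X → E, F =ᵐ[μ.restrict U] f ∧ ∀ x y, ENNReal.ofReal (2 * N * dist x y) ≤ R →
      x ∈ U → y ∈ U → ball x (2 * N * dist x y) ⊆ U →
      dist (F x) (F y) ≤ 8 * (M * β ^ 2) * dist x y := by
  have := h.secondCountableTopology
  have := h.isLocallyFiniteMeasure
  have := h.isUnifLocDoublingMeasure hR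
  let P : X → ℝ → Prop := fun x s => 0 < s ∧ ENNReal.ofReal (N * s) ≤ R ∧ ball x (N * s) ⊆ U
  have hPsub : ∀ {x s}, P x s → ball x s ⊆ U := fun {x s} hs =>
    (ball_subset_ball (le_mul_of_one_le_left hs.1.le (by linarith))).trans hs.2.2
  have hPmono : ∀ x s s', 0 < s' → s' ≤ s → P x s → P x s' := fun x s s' h1 h2 h3 =>
    ⟨h1, (ENNReal.ofReal_le_ofReal (by gcongr)).trans h3.2.1,
      (ball_subset_ball (by gcongr)).trans h3.2.2⟩
  have hPex : ∀ x ∈ U, ∃ s, P x s := by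
    intro x hx
    obtain ⟨ε, hε, hεU⟩ := Metric.isOpen_iff.1 hU x hx
    obtain ⟨ρ, hρ0, hρ⟩ := ENNReal.lt_iff_exists_nnreal_btwn.1 hR
    have hρ0' : (0 : ℝ) < ρ := by exact_mod_cast hρ0
    have hs : N * (min ε ρ / N) = min ε ρ := by field_simp
    refine ⟨min ε ρ / N, by positivity, ?_, ?_⟩
    · rw [hs]
      refine (ENNReal.ofReal_le_ofReal (min_le_right _ _)).trans ?_
      simpa using hρ.le
    · rw [hs]; exact (ball_subset_ball (min_le_left _ _)).trans hεU
  have hcomp : ∀ {x x' s s'} {B' : Set X}, P x s → 0 < s' → s' ≤ s → ball x' s' ⊆ B' →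
      B' ⊆ ball x s → ball x s ⊆ ball x' (4 * s') →
      ‖(⨍ z in B', f z ∂μ) - ⨍ z in ball x s, f z ∂μ‖ ≤ M * β ^ 2 * s := by
    intro x x' s s' B' hs hs' hss h1 h2 h3
    have hs0 := hs.1
    refine (h.norm_setAverage_sub_setAverage_le hs' ?_ h1 h2 h3 (hf.mono_set (hPsub hs))
      (by positivity) (hosc x s hs.1 hs.2.1 hs.2.2)).trans (le_of_eq (by ring))
    exact (ENNReal.ofReal_le_ofReal (by gcongr)).trans hs.2.1
  have hex : ∀ x ∈ U, ∃ v, Tendsto (fun s => ⨍ z in ball x s, f z ∂μ) (𝓝[>] 0) (𝓝 v) ∧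
      ∀ s, P x s → ‖v - ⨍ z in ball x s, f z ∂μ‖ ≤ 2 * (M * β ^ 2) * s := by
    intro x hx
    refine exists_tendsto_of_dyadic (by positivity) (hPmono x) (fun s hs => hs.1) ?_ (hPex x hx)
    intro s s' hs h1 h2
    have hs0 := hs.1
    exact hcomp (x' := x) hs (by linarith) h2 le_rfl (ball_subset_ball h2)
      (ball_subset_ball (by linarith))
  choose! F hFt hF using hex
  refine ⟨F, ?_, fun x y hxyR hx hy hxyU => ?_⟩
  · have hloc : LocallyIntegrable (U.indicator f) μ :=
      ((integrable_indicator_iff hU.measurableSet).2 hf).locallyIntegrable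
    rw [EventuallyEq, ae_restrict_iff' hU.measurableSet]
    filter_upwards [IsUnifLocDoublingMeasure.ae_tendsto_average μ hloc 1] with x hx hxU
    have h1 : Tendsto (fun s => ⨍ z in closedBall x s, U.indicator f z ∂μ) (𝓝[>] 0)
        (𝓝 (U.indicator f x)) := by
      refine hx (fun _ => x) (fun s => s) tendsto_id ?_
      filter_upwards [self_mem_nhdsWithin] with s hs
      exact mem_closedBall_self (by rw [one_mul]; exact (mem_Ioi.1 hs).le)
    rw [indicator_of_mem hxU] at h1
    obtain ⟨s₀, hs₀⟩ := hPex x hxU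
    have hs₀0 := hs₀.1
    have htwo : Tendsto (fun s : ℝ => 2 * s) (𝓝[>] 0) (𝓝[>] 0) := by
      refine tendsto_nhdsWithin_iff.2 ⟨?_, ?_⟩
      · have : Tendsto (fun s : ℝ => 2 * s) (𝓝 0) (𝓝 (2 * 0)) := tendsto_id.const_mul 2
        rw [mul_zero] at this
        exact this.mono_left nhdsWithin_le_nhds
      · filter_upwards [self_mem_nhdsWithin] with s hs
        rw [mem_Ioi] at hs ⊢; linarith
    have h2 := (hFt x hxU).comp htwo
    -- The differentiation theorem gives limits over closed balls, while `F` is a limit over open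
    -- ones. The averages over the closed ball of radius s and the open ball of radius 2s differ by
    -- O(s).
    have h3 : Tendsto (fun s => (⨍ z in closedBall x s, U.indicator f z ∂μ)
        - ⨍ z in ball x (2 * s), f z ∂μ) (𝓝[>] 0) (𝓝 0) := by
      have hlim : Tendsto (fun s : ℝ => M * β ^ 2 * (2 * s)) (𝓝[>] 0) (𝓝 0) := by
        have := (htwo.mono_right nhdsWithin_le_nhds).const_mul (M * (β : ℝ) ^ 2)
        rwa [mul_zero] at this
      refine squeeze_zero_norm' ?_ hlim
      filter_upwards [Ioo_mem_nhdsGT (half_pos hs₀0)] with s hs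
      have hP2 : P x (2 * s) := hPmono x s₀ _ (by linarith [hs.1]) (by linarith [hs.2]) hs₀
      have hsub : closedBall x s ⊆ ball x (2 * s) := closedBall_subset_ball (by linarith [hs.1])
      have hcongr : ⨍ z in closedBall x s, U.indicator f z ∂μ = ⨍ z in closedBall x s, f z ∂μ := by
        refine setAverage_congr_fun measurableSet_closedBall (Eventually.of_forall fun z hz => ?_)
        exact indicator_of_mem (hPsub hP2 (hsub hz)) _
      rw [hcongr]
      exact hcomp (x' := x) (s' := s) hP2 hs.1 (by linarith [hs.1]) ball_subset_closedBall hsub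
        (ball_subset_ball (by linarith [hs.1]))
    have h4 := h1.sub h2
    have h5 := tendsto_nhds_unique h3 h4
    exact (sub_eq_zero.1 h5.symm).symm
  · rcases eq_or_ne x y with rfl | hxy
    · simp
    have hd : 0 < dist x y := dist_pos.2 hxy
    set d := dist x y with hddef
    have hPx : P x (2 * d) := ⟨by positivity, by rwa [← mul_assoc, mul_comm N],
      by rwa [← mul_assoc, mul_comm N]⟩
    have hPy : P y d := by
      refine ⟨hd, (ENNReal.ofReal_le_ofReal (by nlinarith)).trans hxyR, ?_⟩
      refine Subset.trans (ball_subset_ball' ?_) hxyU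
      rw [dist_comm, ← hddef]; nlinarith
    -- In units of M β² d, passing from x to the ball of radius 2d costs 4, from there to the ball
    -- of radius d around y costs 2, and from that ball to y costs 2. The total is 8.
    have h1 := hF x hx _ hPx
    have h2 := hF y hy _ hPy
    have h3 := hcomp (x' := y) (s' := d) hPx hd (by linarith) le_rfl
      (ball_subset_ball' (by rw [dist_comm, ← hddef]; linarith))
      (ball_subset_ball' (by rw [← hddef]; linarith))
    rw [dist_eq_norm]
    rw [norm_sub_rev] at h2 h3
    have h4 := norm_sub_le_norm_sub_add_norm_sub (F x) (⨍ z in ball x (2 * d), f z ∂μ) (F y)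
    have h5 := norm_sub_le_norm_sub_add_norm_sub (⨍ z in ball x (2 * d), f z ∂μ)
      (⨍ z in ball y d, f z ∂μ) (F y)
    linarith

end Representative

/-- A map that is `K`-Lipschitz at small scales along a curve increases its length at most by the
factor `K`. -/
theorem edist_le_mul_eVariationOn {X E : Type*} [PseudoEMetricSpace X] [PseudoEMetricSpace E]
    {F : X → E} {γ : ℝ → X} (hγ : ContinuousOn γ (Icc 0 1)) {K δ : ℝ≥0∞} (hδ : 0 < δ)
    (hF : ∀ s ∈ Icc (0 : ℝ) 1, ∀ t ∈ Icc (0 : ℝ) 1, edist (γ s) (γ t) < δ →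
      edist (F (γ s)) (F (γ t)) ≤ K * edist (γ s) (γ t)) :
    edist (F (γ 0)) (F (γ 1)) ≤ K * eVariationOn γ (Icc 0 1) := by
  have huc := isCompact_Icc.uniformContinuousOn_of_continuous hγ
  rw [EMetric.uniformContinuousOn_iff] at huc
  obtain ⟨η, hη, hηδ⟩ := huc δ hδ
  obtain ⟨n, hn0, hn⟩ : ∃ n : ℕ, 0 < n ∧ ENNReal.ofReal (1 / n) < η := by
    obtain ⟨ρ, hρ0, hρ⟩ := ENNReal.lt_iff_exists_nnreal_btwn.1 hη
    obtain ⟨n, hn⟩ := exists_nat_one_div_lt (show (0 : ℝ) < ρ by exact_mod_cast hρ0)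
    refine ⟨n + 1, n.succ_pos, lt_of_le_of_lt ?_ hρ⟩
    rw [← ENNReal.ofReal_coe_nnreal]
    refine ENNReal.ofReal_le_ofReal ?_
    push_cast; exact hn.le
  have hn0' : (0 : ℝ) < n := by exact_mod_cast hn0
  let u : ℕ → ℝ := fun i => min 1 (i / n)
  have humono : Monotone u := fun i j hij => by
    simp only [u]; gcongr
  have hu : ∀ i, u i ∈ Icc (0 : ℝ) 1 := fun i => ⟨le_min zero_le_one (by positivity), min_le_left _ _⟩
  have hu0 : u 0 = 0 := by simp [u]
  have hun : u n = 1 := by simp [u, hn0'.ne']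
  have hstep : ∀ i, edist (u i) (u (i + 1)) < η := by
    intro i
    refine lt_of_le_of_lt ?_ hn
    rw [edist_comm, edist_dist, Real.dist_eq, abs_of_nonneg (sub_nonneg.2 (humono i.le_succ))]
    refine ENNReal.ofReal_le_ofReal ?_
    have h1 : ((i + 1 : ℕ) : ℝ) / n = i / n + 1 / n := by push_cast; ring
    simp only [u, h1]
    have h2 : (0 : ℝ) ≤ 1 / n := by positivity
    rcases le_total 1 ((i : ℝ) / n) with h | h
    · rw [min_eq_left h, min_eq_left (by linarith)]; linarith
    · rw [min_eq_right h]; linarith [min_le_right (1 : ℝ) (i / n + 1 / n)]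
  calc edist (F (γ 0)) (F (γ 1)) = edist (F (γ (u 0))) (F (γ (u n))) := by rw [hu0, hun]
    _ ≤ ∑ i ∈ Finset.range n, edist (F (γ (u i))) (F (γ (u (i + 1)))) :=
        edist_le_range_sum_edist (fun i => F (γ (u i))) n
    _ ≤ ∑ i ∈ Finset.range n, K * edist (γ (u (i + 1))) (γ (u i)) := by
        refine Finset.sum_le_sum fun i _ => ?_
        rw [edist_comm (γ (u (i + 1)))]
        exact hF _ (hu i) _ (hu (i + 1)) (hηδ (hu i) (hu (i + 1)) (hstep i))
    _ = K * ∑ i ∈ Finset.range n, edist (γ (u (i + 1))) (γ (u i)) := by rw [Finset.mul_sum]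
    _ ≤ K * eVariationOn γ (Icc 0 1) := by
        gcongr
        exact eVariationOn.sum_le humono hu

/-- A compact curve in `U` has a positive distance to the complement, so along it the local
Lipschitz condition holds at a uniform scale. -/
theorem edist_le_mul_eVariationOn_of_ball_subset {X E : Type*} [PseudoMetricSpace X]
    [PseudoEMetricSpace E] {U : Set X} (hU : IsOpen U) {R : ℝ≥0∞} (hR : 0 < R) {C : ℝ≥0}
    {K : ℝ≥0∞} {F : X → E}
    (hF : ∀ x ∈ U, ∀ y ∈ U, C * edist x y ≤ R → ball x (C * dist x y) ⊆ U →
      edist (F x) (F y) ≤ K * edist x y)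
    {γ : ℝ → X} (hγ : ContinuousOn γ (Icc 0 1)) (hγU : MapsTo γ (Icc 0 1) U) :
    edist (F (γ 0)) (F (γ 1)) ≤ K * eVariationOn γ (Icc 0 1) := by
  obtain ⟨δ, hδ, hδU⟩ := (isCompact_Icc.image_of_continuousOn hγ).exists_thickening_subset_open hU
    hγU.image_subset
  obtain ⟨ρ, hρ0, hρR⟩ := ENNReal.lt_iff_exists_nnreal_btwn.1
    (lt_min hR (ENNReal.ofReal_pos.2 hδ))
  have hρ0' : 0 < ρ := by exact_mod_cast hρ0
  -- Dividing by C + 1 keeps the denominator positive and makes C times the distance at most ρ.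
  refine edist_le_mul_eVariationOn hγ (δ := ((ρ / (C + 1) : ℝ≥0) : ℝ≥0∞))
    (by exact_mod_cast (by positivity : 0 < ρ / (C + 1))) fun s hs t ht hst => ?_
  have hst' : dist (γ s) (γ t) < ρ / (C + 1) := by
    rw [edist_dist, ← ENNReal.ofReal_coe_nnreal] at hst
    exact_mod_cast (ENNReal.ofReal_lt_ofReal_iff'.1 hst).1
  have hC : (C : ℝ) * dist (γ s) (γ t) ≤ ρ := by
    rw [lt_div_iff₀ (by positivity)] at hst'
    nlinarith [dist_nonneg (x := γ s) (y := γ t)]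
  have hCρ : ENNReal.ofReal (C * dist (γ s) (γ t)) ≤ ρ := by
    rw [← ENNReal.ofReal_coe_nnreal (p := ρ)]; exact ENNReal.ofReal_le_ofReal hC
  refine hF _ (hγU hs) _ (hγU ht) ?_ ?_
  · rw [edist_dist, ← ENNReal.ofReal_coe_nnreal (p := C), ← ENNReal.ofReal_mul C.coe_nonneg]
    exact hCρ.trans (hρR.le.trans (min_le_left _ _))
  · refine Subset.trans (fun z hz => ?_) hδU
    refine mem_thickening_iff.2 ⟨γ s, mem_image_of_mem _ hs, (mem_ball.1 hz).trans_le (hC.trans ?_)⟩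
    have := hρR.le.trans (min_le_right _ _)
    rw [← ENNReal.ofReal_coe_nnreal (p := ρ)] at this
    exact (ENNReal.ofReal_le_ofReal_iff hδ.le).1 this

/-! ### Lipschitz estimates from a bound on the total perimeter -/

section

variable {X Y : Type*} [MetricSpace X] [MeasurableSpace X] [BorelSpace X] [MeasurableSpace Y]
  {μ : Measure X} {ν : Measure Y} {R : ℝ≥0∞} {β Λ τ : ℝ≥0}

/-- The dilated ball of radius Λs lies in the ball of radius 2^k s, whose measure costs β^k. The
oscillation is then at most M s μ(B)² with M = 2(τ + 1)Lβ^k, and 8Mβ² gives the constant 16(τ +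
1)β^(k+2). The bound 2 ≤ k provides the dilation 2^k ≥ 4 required for the representative. -/
theorem IsPIMeasure.exists_lipschitz_of_totalPerimeter_le [SFinite ν] (h : IsPIMeasure μ R β Λ τ)
    (hΛ : 1 ≤ Λ) (hR : 0 < R) {U : Set X} (hU : IsOpen U) {f : X → Lp ℝ 1 ν}
    (hf : MemLp f 1 (μ.restrict U)) {L : ℝ≥0}
    (hL : ∀ (x : X) (r : ℝ), 0 < r → ball x r ⊆ U →
      totalPerimeter μ U (cutMeasure (μ.restrict U) ν f) (ball x r) ≤ L * μ (ball x r))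
    {k : ℕ} (hk : 2 ≤ k) (hkΛ : Λ < 2 ^ k) {C : ℝ≥0} (hC1 : 2 * 2 ^ k ≤ C)
    (hC2 : 16 * (τ + 1) * β ^ (k + 2) ≤ C) :
    ∃ F : X → Lp ℝ 1 ν, F =ᵐ[μ.restrict U] f ∧
      ∀ x ∈ U, ∀ y ∈ U, C * edist x y ≤ R → ball x (C * dist x y) ⊆ U →
        edist (F x) (F y) ≤ C * L * edist x y := by
  have hkΛ' : (Λ : ℝ) < 2 ^ k := by exact_mod_cast hkΛ
  have hC1' : (2 : ℝ) * 2 ^ k ≤ C := by exact_mod_cast hC1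
  have hC2' : (16 : ℝ) * (τ + 1) * β ^ (k + 2) ≤ C := by exact_mod_cast hC2
  have hfi : IntegrableOn f U μ := memLp_one_iff_integrable.1 hf
  have hN : (4 : ℝ) ≤ 2 ^ k := by
    calc (4 : ℝ) = 2 ^ 2 := by norm_num
      _ ≤ 2 ^ k := pow_le_pow_right₀ (by norm_num) hk
  have hosc : ∀ (x : X) (s : ℝ), 0 < s → ENNReal.ofReal (2 ^ k * s) ≤ R → ball x (2 ^ k * s) ⊆ U →
      doubleOsc μ (ball x s) f
        ≤ ENNReal.ofReal (2 * (τ + 1) * L * β ^ k * s) * μ (ball x s) ^ 2 := by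
    intro x s hs hsR hsU
    have hs1 : s ≤ 2 ^ k * s := le_mul_of_one_le_left hs.le (one_le_pow₀ (by norm_num))
    refine (h.doubleOsc_le_totalPerimeter hΛ hf hs ((ENNReal.ofReal_le_ofReal hs1).trans hsR)
      isOpen_ball (closedBall_subset_ball (by gcongr)) hsU).trans ?_
    calc 2 * μ (ball x s) * (ENNReal.ofReal s * (τ + 1)) *
          totalPerimeter μ U (cutMeasure (μ.restrict U) ν f) (ball x (2 ^ k * s))
        ≤ 2 * μ (ball x s) * (ENNReal.ofReal s * (τ + 1)) * (L * (β ^ k * μ (ball x s))) := by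
          gcongr
          refine (hL x _ (by positivity) hsU).trans ?_
          gcongr
          exact h.measure_ball_two_pow_mul_le x k hs hsR
      _ = (2 * (τ + 1) * L * β ^ k * ENNReal.ofReal s) * μ (ball x s) ^ 2 := by ring
      _ = ENNReal.ofReal (2 * (τ + 1) * L * β ^ k * s) * μ (ball x s) ^ 2 := by
          congr 1
          have : (2 * (τ + 1) * L * β ^ k : ℝ) = ((2 * (τ + 1) * L * β ^ k : ℝ≥0) : ℝ) := by
            push_cast; ring
          rw [this, ENNReal.ofReal_mul (NNReal.coe_nonneg _), ENNReal.ofReal_coe_nnreal]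
          push_cast; ring
  obtain ⟨F, hFf, hF⟩ :=
    h.exists_lipschitz_representative hR hU hfi hN (by positivity) hosc
  refine ⟨F, hFf, fun x hx y hy hxyR hxyU => ?_⟩
  have hd : 2 * 2 ^ k * dist x y ≤ C * dist x y := by gcongr
  have h1 := hF x y ?_ hx hy ((ball_subset_ball hd).trans hxyU)
  · rw [edist_dist, edist_dist, ← ENNReal.ofReal_coe_nnreal (p := C),
      ← ENNReal.ofReal_coe_nnreal (p := L), ← ENNReal.ofReal_mul C.coe_nonneg,
      ← ENNReal.ofReal_mul (by positivity)]
    refine ENNReal.ofReal_le_ofReal (h1.trans ?_)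
    refine mul_le_mul_of_nonneg_right ?_ dist_nonneg
    calc (8 : ℝ) * (2 * (τ + 1) * L * β ^ k * β ^ 2) = 16 * (τ + 1) * β ^ (k + 2) * L := by ring
      _ ≤ C * L := by gcongr
  · refine (ENNReal.ofReal_le_ofReal hd).trans ?_
    rwa [ENNReal.ofReal_mul C.coe_nonneg, ENNReal.ofReal_coe_nnreal, ← edist_dist]

end

/-! ### The coarea inequality -/

section Ramp

/-- A `K`-Lipschitz approximation of `sliceInd t`. -/
noncomputable def sliceRamp (K : ℝ≥0) (t a : ℝ) : ℝ :=
  max 0 (min 1 ((if 0 < t then a - t else t - a) * K + 1))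

theorem lipschitzWith_sliceRamp (K : ℝ≥0) (t : ℝ) : LipschitzWith K (sliceRamp K t) := by
  have h : LipschitzWith K fun a => (if 0 < t then a - t else t - a) * K + 1 := by
    refine LipschitzWith.of_dist_le_mul fun a b => le_of_eq ?_
    rw [Real.dist_eq, Real.dist_eq]
    split_ifs
    · rw [show (a - t) * (K : ℝ) + 1 - ((b - t) * K + 1) = K * (a - b) by ring, abs_mul,
        NNReal.abs_eq]
    · rw [show (t - a) * (K : ℝ) + 1 - ((t - b) * K + 1) = K * -(a - b) by ring, abs_mul,
        NNReal.abs_eq, abs_neg]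
  exact (h.const_min 1).const_max 0

theorem measurable_sliceRamp (K : ℝ≥0) : Measurable fun p : ℝ × ℝ => sliceRamp K p.1 p.2 := by
  refine measurable_const.max (measurable_const.min (((Measurable.ite ?_ ?_ ?_).mul_const _).add_const 1))
  · exact measurableSet_lt measurable_const measurable_fst
  · exact measurable_snd.sub measurable_fst
  · exact measurable_fst.sub measurable_snd

theorem sliceRamp_eq_one {K : ℝ≥0} {t a : ℝ} (h : 0 ≤ if 0 < t then a - t else t - a) :
    sliceRamp K t a = 1 := by
  have : 1 ≤ (if 0 < t then a - t else t - a) * K + 1 := le_add_of_nonneg_left (by positivity)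
  rw [sliceRamp, min_eq_left this, max_eq_right zero_le_one]

theorem sliceRamp_eq_zero {K : ℝ≥0} (hK : 0 < K) {t a : ℝ}
    (h : (if 0 < t then a - t else t - a) ≤ -(K : ℝ)⁻¹) : sliceRamp K t a = 0 := by
  have hK' : (0 : ℝ) < K := hK
  have : (if 0 < t then a - t else t - a) * (K : ℝ) + 1 ≤ 0 := by
    have := mul_le_mul_of_nonneg_right h hK'.le
    rw [neg_mul, inv_mul_cancel₀ hK'.ne'] at this
    linarith
  exact max_eq_left ((min_le_right _ _).trans this)

theorem eventually_sliceRamp_eq {K : ℝ≥0} (hK : 0 < K) {t a : ℝ} (h : (K : ℝ)⁻¹ < |a - t|) :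
    ∀ᶠ a' in 𝓝 a, sliceRamp K t a' = sliceRamp K t a := by
  have hK' : (0 : ℝ) < (K : ℝ)⁻¹ := by positivity
  have hcont : Continuous fun a' : ℝ => if 0 < t then a' - t else t - a' := by
    split_ifs <;> fun_prop
  rcases lt_abs.1 (show (K : ℝ)⁻¹ < |if 0 < t then a - t else t - a| by
    split_ifs; exacts [h, by rwa [abs_sub_comm]]) with h1 | h1
  · filter_upwards [hcont.continuousAt.eventually_const_lt h1] with a' ha'
    rw [sliceRamp_eq_one (hK'.trans ha').le, sliceRamp_eq_one (hK'.trans h1).le]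
  · filter_upwards [hcont.continuousAt.eventually_lt_const (lt_neg_of_lt_neg h1)] with a' ha'
    rw [sliceRamp_eq_zero hK (by linarith), sliceRamp_eq_zero hK (by linarith)]

theorem sliceInd_eq_ite {t : ℝ} (ht : t ≠ 0) (b : ℝ) :
    sliceInd t b = if 0 ≤ (if 0 < t then b - t else t - b) then 1 else 0 := by
  rcases lt_or_gt_of_ne ht with h | h <;> simp [sliceInd, h, h.not_gt]

/-- If t is farther than |a - b| + 1/K from b, then a and b lie on the same side of t and a is at
distance more than 1/K from t, where the ramp has already reached the value 0 or 1. -/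
theorem enorm_sliceRamp_sub_sliceInd_le {K : ℝ≥0} (hK : 0 < K) {t : ℝ} (ht : t ≠ 0) (a b : ℝ) :
    ‖sliceRamp K t a - sliceInd t b‖ₑ
      ≤ (closedBall b (|a - b| + (K : ℝ)⁻¹)).indicator 1 t := by
  rw [sliceInd_eq_ite ht]
  by_cases h : t ∈ closedBall b (|a - b| + (K : ℝ)⁻¹)
  · rw [indicator_of_mem h, Pi.one_apply, Real.enorm_eq_ofReal_abs, ← ENNReal.ofReal_one]
    refine ENNReal.ofReal_le_ofReal ?_
    have h1 : 0 ≤ sliceRamp K t a := le_max_left _ _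
    have h2 : sliceRamp K t a ≤ 1 := max_le zero_le_one (min_le_left _ _)
    split_ifs <;> rw [abs_le] <;> constructor <;> linarith
  · rw [indicator_of_notMem h]
    rw [mem_closedBall, Real.dist_eq, not_le] at h
    have hK' : (0 : ℝ) < (K : ℝ)⁻¹ := by positivity
    have h3 := abs_le.1 (le_refl |a - b|)
    split_ifs with h0 h1 h1
    · have : sliceRamp K t a = 1 := sliceRamp_eq_one (by
        rw [if_pos h0]; rw [abs_of_nonpos (a := t - b) (by linarith)] at h; linarith)
      simp [this]
    · have : sliceRamp K t a = 0 := sliceRamp_eq_zero hK (by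
        rw [if_pos h0]; rw [abs_of_pos (a := t - b) (by linarith)] at h; linarith)
      simp [this]
    · have : sliceRamp K t a = 1 := sliceRamp_eq_one (by
        rw [if_neg h0]; rw [abs_of_nonneg (a := t - b) (by linarith)] at h; linarith)
      simp [this]
    · have : sliceRamp K t a = 0 := sliceRamp_eq_zero hK (by
        rw [if_neg h0]; rw [abs_of_neg (a := t - b) (by linarith)] at h; linarith)
      simp [this]

theorem lintegral_enorm_sliceRamp_sub_sliceInd_le {K : ℝ≥0} (hK : 0 < K) (a b : ℝ) :
    ∫⁻ t, ‖sliceRamp K t a - sliceInd t b‖ₑ ≤ 2 * ‖a - b‖ₑ + 2 * (K : ℝ≥0∞)⁻¹ := by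
  have hK' : (0 : ℝ) < (K : ℝ)⁻¹ := by positivity
  calc ∫⁻ t, ‖sliceRamp K t a - sliceInd t b‖ₑ
      ≤ ∫⁻ t, (closedBall b (|a - b| + (K : ℝ)⁻¹)).indicator 1 t := by
        refine lintegral_mono_ae ?_
        filter_upwards [Measure.ae_ne volume 0] with t ht
        exact enorm_sliceRamp_sub_sliceInd_le hK ht a b
    _ = 2 * ‖a - b‖ₑ + 2 * (K : ℝ≥0∞)⁻¹ := by
        rw [lintegral_indicator_one measurableSet_closedBall, Real.volume_closedBall,
          Real.enorm_eq_ofReal_abs, ← mul_add, ENNReal.ofReal_mul zero_le_two,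
          ENNReal.ofReal_add (abs_nonneg _) hK'.le, ENNReal.ofReal_inv_of_pos (by exact_mod_cast hK),
          ENNReal.ofReal_coe_nnreal]
        simp

end Ramp

theorem _root_.LocallyLipschitzOn.lipschitzWith_comp {X V W : Type*} [PseudoEMetricSpace X]
    [PseudoEMetricSpace V] [PseudoEMetricSpace W] {A : Set X} {v : X → V}
    (hv : LocallyLipschitzOn A v) {K : ℝ≥0} {φ : V → W} (hφ : LipschitzWith K φ) :
    LocallyLipschitzOn A fun x => φ (v x) := fun x hx => by
  obtain ⟨K', s, hs, hK'⟩ := hv hx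
  exact ⟨K * K', s, hs, hφ.comp_lipschitzOnWith hK'⟩

section Coarea

variable {X : Type*} [MetricSpace X]

/-- The ramp is locally constant at v x unless t is within 1/K of v x. The slope K thus lives on
levels of total length 2/K, which is why integrating over t leaves a bound independent of K. -/
theorem pointLip_sliceRamp_le {K : ℝ≥0} (hK : 0 < K) {v : X → ℝ} {x : X} {D : ℝ≥0∞}
    (hv : ContinuousAt v x) (hD : ∀ᶠ x' in 𝓝 x, edist (v x) (v x') ≤ D * edist x x') (t : ℝ) :
    pointLip (fun z => sliceRamp K t (v z)) x
      ≤ K * (closedBall (v x) (K : ℝ)⁻¹).indicator 1 t * D := by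
  by_cases h : t ∈ closedBall (v x) (K : ℝ)⁻¹
  · rw [indicator_of_mem h, Pi.one_apply, mul_one]
    refine pointLip_le ?_
    filter_upwards [hD] with x' hx'
    rw [mul_assoc]
    exact (lipschitzWith_sliceRamp K t _ _).trans (mul_le_mul_right hx' _)
  · rw [indicator_of_notMem h, mul_zero, zero_mul]
    rw [mem_closedBall', Real.dist_eq, not_le] at h
    refine pointLip_le ?_
    filter_upwards [hv.eventually (eventually_sliceRamp_eq hK h)] with x' hx'
    simp [hx']

/-- A coarea inequality. Ramps of `v n` approximate almost every slice of `u` in L¹, and the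
integral over t of their slopes is at most 2 `D n`; Fatou in t concludes. The variation need not be
measurable in t. -/
theorem lintegral_variation_sliceInd_le [MeasurableSpace X] [BorelSpace X] {μ : Measure X}
    [SFinite μ] {A : Set X} (hA : IsOpen A) (hμA : μ A ≠ ∞)
    {u : X → ℝ} (hu : Measurable u) {v : ℕ → X → ℝ} (hvm : ∀ n, Measurable (v n))
    (hv : ∀ n, LocallyLipschitzOn A (v n)) {D : ℕ → X → ℝ≥0∞} (hDm : ∀ n, Measurable (D n))
    (hD : ∀ n, ∀ x ∈ A, ∀ᶠ x' in 𝓝 x, edist (v n x) (v n x') ≤ D n x * edist x x')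
    (hsum : ∑' n, ∫⁻ x in A, ‖v n x - u x‖ₑ ∂μ ≠ ∞) :
    ∫⁻ t, variation μ (fun x => sliceInd t (u x)) A
      ≤ 2 * liminf (fun n => ∫⁻ x in A, D n x ∂μ) atTop := by
  -- Geometric growth, together with `hsum`, makes the L¹ errors summable after integration over t,
  -- so that they tend to 0 for almost every t along one sequence common to all levels.
  let K : ℕ → ℝ≥0 := fun n => 2 ^ n
  have hK : ∀ n, 0 < K n := fun n => by positivity
  let J : ℕ → ℝ → ℝ≥0∞ := fun n t =>
    ∫⁻ x in A, K n * (closedBall (v n x) (K n : ℝ)⁻¹).indicator 1 t * D n x ∂μ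
  let E : ℕ → ℝ → ℝ≥0∞ := fun n t => ∫⁻ x in A, ‖sliceRamp (K n) t (v n x) - sliceInd t (u x)‖ₑ ∂μ
  have hJm0 : ∀ n, Measurable fun p : ℝ × X =>
      (K n : ℝ≥0∞) * (closedBall (v n p.2) (K n : ℝ)⁻¹).indicator 1 p.1 * D n p.2 := by
    intro n
    refine (measurable_const.mul (Measurable.ite (p := fun p : ℝ × X => p.1 ∈ closedBall (v n p.2) _)
      ?_ measurable_const measurable_const)).mul ((hDm n).comp measurable_snd)
    exact measurableSet_le (measurable_fst.dist ((hvm n).comp measurable_snd)) measurable_const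
  have hEm0 : ∀ n, Measurable fun p : ℝ × X =>
      ‖sliceRamp (K n) p.1 (v n p.2) - sliceInd p.1 (u p.2)‖ₑ := fun n =>
    (((measurable_sliceRamp (K n)).comp (measurable_fst.prodMk ((hvm n).comp measurable_snd))).sub
      (measurable_sliceInd.comp (measurable_fst.prodMk (hu.comp measurable_snd)))).enorm
  have hJint : ∀ n, ∫⁻ t, J n t = 2 * ∫⁻ x in A, D n x ∂μ := by
    intro n
    rw [lintegral_lintegral_swap (hJm0 n).aemeasurable, ← lintegral_const_mul _ (hDm n)]
    refine lintegral_congr fun x => ?_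
    have hind : Measurable fun t => (closedBall (v n x) (K n : ℝ)⁻¹).indicator (1 : ℝ → ℝ≥0∞) t :=
      measurable_one.indicator measurableSet_closedBall
    rw [lintegral_mul_const _ (hind.const_mul _), lintegral_const_mul _ hind,
      lintegral_indicator_one measurableSet_closedBall, Real.volume_closedBall,
      ENNReal.ofReal_mul zero_le_two, ENNReal.ofReal_inv_of_pos (by exact_mod_cast hK n),
      ENNReal.ofReal_coe_nnreal, mul_left_comm, ENNReal.mul_inv_cancel (by simpa using (hK n).ne')
      ENNReal.coe_ne_top]
    simp
  have hEint : ∀ n, ∫⁻ t, E n t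
      ≤ 2 * ∫⁻ x in A, ‖v n x - u x‖ₑ ∂μ + 2 * μ A * ((1 / 2 : ℝ≥0∞) ^ n) := by
    intro n
    rw [lintegral_lintegral_swap (hEm0 n).aemeasurable]
    calc ∫⁻ x in A, ∫⁻ t, ‖sliceRamp (K n) t (v n x) - sliceInd t (u x)‖ₑ ∂volume ∂μ
        ≤ ∫⁻ x in A, (2 * ‖v n x - u x‖ₑ + 2 * (K n : ℝ≥0∞)⁻¹) ∂μ :=
          lintegral_mono fun x => lintegral_enorm_sliceRamp_sub_sliceInd_le (hK n) _ _
      _ = _ := by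
          have hvu : Measurable fun x => ‖v n x - u x‖ₑ := ((hvm n).sub hu).enorm
          rw [lintegral_add_right _ measurable_const, lintegral_const_mul _ hvu, setLIntegral_const]
          simp only [K, ENNReal.coe_pow, ENNReal.coe_ofNat, one_div, ENNReal.inv_pow]
          ring
  have hElim : ∀ᵐ t, Tendsto (fun n => E n t) atTop (𝓝 0) := by
    have hEm : ∀ n, Measurable (E n) := fun n => (hEm0 n).lintegral_prod_right'
    have hfin : ∫⁻ t, ∑' n, E n t ≠ ∞ := by
      rw [lintegral_tsum fun n => (hEm n).aemeasurable]
      refine ne_top_of_le_ne_top ?_ (ENNReal.tsum_le_tsum hEint)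
      rw [ENNReal.tsum_add, ENNReal.tsum_mul_left, ENNReal.tsum_mul_left]
      refine ENNReal.add_ne_top.2 ⟨ENNReal.mul_ne_top (by simp) hsum,
        ENNReal.mul_ne_top (ENNReal.mul_ne_top (by simp) hμA) ?_⟩
      rw [one_div, ENNReal.tsum_geometric, ENNReal.one_sub_inv_two, inv_inv]
      simp
    filter_upwards [ae_lt_top (Measurable.tsum hEm) hfin] with t ht
    exact ENNReal.tendsto_atTop_zero_of_tsum_ne_top ht.ne
  calc ∫⁻ t, variation μ (fun x => sliceInd t (u x)) A
      ≤ ∫⁻ t, liminf (fun n => J n t) atTop := by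
        refine lintegral_mono_ae ?_
        filter_upwards [hElim] with t ht
        refine (variation_le (hs := fun n x => sliceRamp (K n) t (v n x))
          (fun n => (hv n).lipschitzWith_comp (lipschitzWith_sliceRamp (K n) t)) ?_).trans ?_
        · simp only [eLpNorm_one_eq_lintegral_enorm]
          exact ht
        · refine liminf_le_liminf (Eventually.of_forall fun n => ?_)
          refine setLIntegral_mono' hA.measurableSet fun x hx => ?_
          exact pointLip_sliceRamp_le (hK n)
            ((hv n).continuousOn.continuousAt (hA.mem_nhds hx)) (hD n x hx) t
    _ ≤ liminf (fun n => ∫⁻ t, J n t) atTop :=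
        lintegral_liminf_le fun n => (hJm0 n).lintegral_prod_right'
    _ = 2 * liminf (fun n => ∫⁻ x in A, D n x ∂μ) atTop := by
        simp only [hJint]
        exact ENNReal.liminf_const_mul_of_ne_top (by simp)

end Coarea

/-! ### Smoothing at a variable scale -/

section Smoothing

theorem abs_integral_mul_le {X : Type*} [MeasurableSpace X] {μ : Measure X} {B : Set X}
    (hB : MeasurableSet B) {φ g : X → ℝ} {C : ℝ} (hφ : ∀ w ∈ B, |φ w| ≤ C)
    (hφ0 : ∀ w ∉ B, φ w = 0) (hg : IntegrableOn g B μ) :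
    |∫ w, φ w * g w ∂μ| ≤ C * ∫ w in B, |g w| ∂μ := by
  have h0 : ∀ w ∉ B, φ w * g w = 0 := fun w hw => by rw [hφ0 w hw, zero_mul]
  rw [← setIntegral_eq_integral_of_forall_compl_eq_zero h0, ← integral_const_mul]
  have h1 : ∀ᵐ w ∂μ.restrict B, ‖φ w * g w‖ ≤ C * ‖g w‖ := by
    filter_upwards [ae_restrict_mem hB] with w hw
    rw [norm_mul]
    exact mul_le_mul_of_nonneg_right (hφ w hw) (norm_nonneg _)
  exact norm_integral_le_of_norm_le (hg.norm.const_mul C) h1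

variable {X : Type*} [MetricSpace X]

/-- The tent function at the scale `δ z` around `z`. -/
noncomputable def tent (δ : X → ℝ) (z w : X) : ℝ := max 0 (δ z - dist z w)

variable {δ : X → ℝ}

theorem tent_nonneg (z w : X) : 0 ≤ tent δ z w := le_max_left _ _

theorem tent_le {z : X} (hz : 0 ≤ δ z) (w : X) : tent δ z w ≤ δ z :=
  max_le hz (sub_le_self _ dist_nonneg)

theorem tent_eq_zero {z w : X} (h : δ z ≤ dist z w) : tent δ z w = 0 :=
  max_eq_left (sub_nonpos.2 h)

theorem abs_tent_sub_le (hδ : LipschitzWith 1 δ) (z z' w : X) :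
    |tent δ z' w - tent δ z w| ≤ 2 * dist z z' := by
  rw [tent, tent]
  refine (abs_max_sub_max_le_max _ _ _ _).trans ?_
  rw [sub_self, abs_zero, max_eq_right (abs_nonneg _)]
  have h1 := hδ.dist_le_mul z z'
  rw [Real.dist_eq, NNReal.coe_one, one_mul] at h1
  have h2 := abs_dist_sub_le z z' w
  rw [abs_le] at *
  constructor <;> linarith [h1.1, h1.2, h2.1, h2.2]

/-- Moving the centre by at most δ z / 2 raises the radius to at most 3 δ z / 2, so every nearby
tent is supported in the same ball of radius 2 δ z. -/
theorem tent_eq_zero_of_notMem_ball (hδ : LipschitzWith 1 δ) {z z' w : X}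
    (hz : dist z z' ≤ δ z / 2) (hw : w ∉ ball z (2 * δ z)) : tent δ z' w = 0 := by
  refine tent_eq_zero ?_
  have h1 := hδ.dist_le_mul z z'
  rw [Real.dist_eq, NNReal.coe_one, one_mul] at h1
  have h2 := dist_triangle z z' w
  rw [mem_ball, dist_comm, not_lt] at hw
  linarith [(abs_le.1 h1).1]

theorem continuous_tent (hδ : Continuous δ) : Continuous fun p : X × X => tent δ p.1 p.2 :=
  continuous_const.max ((hδ.comp continuous_fst).sub (continuous_fst.dist continuous_snd))

variable [MeasurableSpace X] {μ : Measure X}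

/-- The average of `h` against the tent function at scale `δ z` around `z`. -/
noncomputable def smoothing (μ : Measure X) (δ h : X → ℝ) (z : X) : ℝ :=
  (∫ w, tent δ z w * h w ∂μ) / ∫ w, tent δ z w ∂μ

variable {R : ℝ≥0∞} {β Λ τ : ℝ≥0}

/-- The factor β² + 1, unlike β², is at least 1 whatever β is, which later allows division by it. -/
theorem IsPIMeasure.measureReal_ball_le (hμ : IsPIMeasure μ R β Λ τ)
    {z : X} (hz : 0 < δ z) (hzR : ENNReal.ofReal (2 * δ z) ≤ R) :
    μ.real (ball z (2 * δ z)) ≤ (β ^ 2 + 1) * μ.real (ball z (δ z / 2)) := by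
  have h := hμ.measure_ball_two_pow_mul_le z 2 (half_pos hz) (by convert hzR using 2; ring)
  rw [show (2 : ℝ) ^ 2 * (δ z / 2) = 2 * δ z by ring] at h
  have h2 := ENNReal.toReal_mono
    (ENNReal.mul_ne_top (by simp) (hμ.ball_lt_top z (δ z / 2)).ne) h
  rw [ENNReal.toReal_mul] at h2
  simp only [ENNReal.toReal_pow, ENNReal.coe_toReal] at h2
  refine h2.trans (mul_le_mul_of_nonneg_right (by linarith) measureReal_nonneg)

theorem IsPIMeasure.measureReal_ball_pos (hμ : IsPIMeasure μ R β Λ τ) (z : X) {r : ℝ}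
    (hr : 0 < r) : 0 < μ.real (ball z r) :=
  ENNReal.toReal_pos (hμ.ball_pos z r hr).ne' (hμ.ball_lt_top z r).ne

variable [BorelSpace X]

theorem IsPIMeasure.integrable_tent (hμ : IsPIMeasure μ R β Λ τ) (hδ : Continuous δ) (z : X) :
    Integrable (tent δ z) μ := by
  have hc : Continuous (tent δ z) := (continuous_tent hδ).comp (Continuous.prodMk_right z)
  refine (integrableOn_iff_integrable_of_support_subset (s := ball z (δ z)) fun w hw => ?_).1
    (Measure.integrableOn_of_bounded (hμ.ball_lt_top _ _).ne hc.aestronglyMeasurable (M := |δ z|) ?_)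
  · by_contra hw'
    rw [mem_ball, dist_comm, not_lt] at hw'
    exact hw (tent_eq_zero hw')
  · refine Eventually.of_forall fun w => ?_
    rw [Real.norm_eq_abs, abs_of_nonneg (tent_nonneg _ _)]
    exact max_le (abs_nonneg _) ((sub_le_self _ dist_nonneg).trans (le_abs_self _))

theorem integrable_tent_mul (hδ : Continuous δ) {h : X → ℝ} (hh : Integrable h μ) (z : X) :
    Integrable (fun w => tent δ z w * h w) μ := by
  have hc : Continuous (tent δ z) := (continuous_tent hδ).comp (Continuous.prodMk_right z)
  refine hh.bdd_mul (c := |δ z|) hc.aestronglyMeasurable (Eventually.of_forall fun w => ?_)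
  rw [Real.norm_eq_abs, abs_of_nonneg (tent_nonneg _ _)]
  exact max_le (abs_nonneg _) ((sub_le_self _ dist_nonneg).trans (le_abs_self _))

/-- The tent is at least δ z / 2 on the ball of radius δ z / 2, and two doublings lead from that
ball to the one of radius 2 δ z. -/
theorem IsPIMeasure.le_integral_tent (hμ : IsPIMeasure μ R β Λ τ) (hδ : Continuous δ)
    {z : X} (hz : 0 < δ z) (hzR : ENNReal.ofReal (2 * δ z) ≤ R) :
    δ z * μ.real (ball z (2 * δ z)) ≤ 2 * (β ^ 2 + 1) * ∫ w, tent δ z w ∂μ := by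
  have h1 : μ.real (ball z (δ z / 2)) * (δ z / 2) ≤ ∫ w, tent δ z w ∂μ := by
    rw [← smul_eq_mul, ← setIntegral_const]
    refine (setIntegral_mono_on (integrableOn_const (hμ.ball_lt_top _ _).ne)
      (hμ.integrable_tent hδ z).integrableOn measurableSet_ball fun w hw => ?_).trans
      (setIntegral_le_integral (hμ.integrable_tent hδ z)
        (Eventually.of_forall fun w => tent_nonneg z w))
    rw [mem_ball, dist_comm] at hw
    exact le_max_of_le_right (by linarith)
  have h2 := hμ.measureReal_ball_le hz hzR
  nlinarith

theorem IsPIMeasure.integral_tent_pos (hμ : IsPIMeasure μ R β Λ τ) (hδ : Continuous δ)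
    {z : X} (hz : 0 < δ z) (hzR : ENNReal.ofReal (2 * δ z) ≤ R) : 0 < ∫ w, tent δ z w ∂μ := by
  have h1 := hμ.le_integral_tent hδ hz hzR
  have h2 : 0 < δ z * μ.real (ball z (2 * δ z)) :=
    mul_pos hz (hμ.measureReal_ball_pos z (by positivity))
  exact pos_of_mul_pos_right (h2.trans_le h1) (by positivity)

/-- With d = dist z z' and M the measure of the ball of radius 2 δ z, the masses differ by at most
2dM. Since δ z M is at most 2(β² + 1) times the mass, the factor 8 in `hzz` makes this difference at
most half of the mass. -/
theorem IsPIMeasure.half_integral_tent_le (hμ : IsPIMeasure μ R β Λ τ) (hδ : LipschitzWith 1 δ)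
    {z z' : X} (hz : 0 < δ z) (hzR : ENNReal.ofReal (2 * δ z) ≤ R)
    (hzz : dist z z' ≤ δ z / (8 * (β ^ 2 + 1))) :
    |∫ w, tent δ z' w ∂μ - ∫ w, tent δ z w ∂μ| ≤ 2 * dist z z' * μ.real (ball z (2 * δ z)) ∧
      (∫ w, tent δ z w ∂μ) / 2 ≤ ∫ w, tent δ z' w ∂μ := by
  have hb : (0 : ℝ) < β ^ 2 + 1 := by positivity
  have hb1 : (1 : ℝ) ≤ β ^ 2 + 1 := le_add_of_nonneg_left (by positivity)
  have hzz' : dist z z' ≤ δ z / 2 := hzz.trans (by gcongr; linarith)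
  have h1 : |∫ w, tent δ z' w ∂μ - ∫ w, tent δ z w ∂μ| ≤ 2 * dist z z' * μ.real (ball z (2 * δ z)) := by
    rw [← integral_sub (hμ.integrable_tent hδ.continuous z') (hμ.integrable_tent hδ.continuous z)]
    have := abs_integral_mul_le (μ := μ) (B := ball z (2 * δ z)) measurableSet_ball
      (φ := fun w => tent δ z' w - tent δ z w) (g := fun _ => 1) (C := 2 * dist z z')
      (fun w _ => abs_tent_sub_le hδ z z' w) (fun w hw => by
        rw [tent_eq_zero_of_notMem_ball hδ hzz' hw,
          tent_eq_zero_of_notMem_ball hδ (by rw [dist_self]; positivity) hw, sub_zero])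
      (integrableOn_const (hμ.ball_lt_top _ _).ne)
    simpa using this
  refine ⟨h1, ?_⟩
  have h2 := hμ.le_integral_tent hδ.continuous hz hzR
  have hM := measureReal_nonneg (μ := μ) (s := ball z (2 * δ z))
  rw [le_div_iff₀ (by positivity)] at hzz
  have h3 : 2 * dist z z' * μ.real (ball z (2 * δ z)) ≤ (∫ w, tent δ z w ∂μ) / 2 := by
    have h4 := mul_le_mul_of_nonneg_right hzz hM
    have h5 : 0 ≤ (β ^ 2 + 1) * ((∫ w, tent δ z w ∂μ) / 2 - 2 * dist z z' * μ.real (ball z (2 * δ z))) := by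
      nlinarith
    linarith [nonneg_of_mul_nonneg_right h5 hb]
  linarith [(abs_le.1 h1).1]

theorem IsPIMeasure.smoothing_sub_const (hμ : IsPIMeasure μ R β Λ τ) (hδ : Continuous δ)
    {z : X} (hz : 0 < ∫ w, tent δ z w ∂μ) {h : X → ℝ} (hh : Integrable h μ) (c : ℝ) :
    smoothing μ δ h z - c = (∫ w, tent δ z w * (h w - c) ∂μ) / ∫ w, tent δ z w ∂μ := by
  have h1 : ∫ w, tent δ z w * (h w - c) ∂μ
      = ∫ w, tent δ z w * h w ∂μ - (∫ w, tent δ z w ∂μ) * c := by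
    rw [← integral_mul_const, ← integral_sub (integrable_tent_mul hδ hh z)
      ((hμ.integrable_tent hδ z).mul_const c)]
    simp only [mul_sub]
  rw [h1, smoothing, sub_div, mul_div_cancel_left₀ _ hz.ne']

theorem IsPIMeasure.abs_smoothing_sub_le (hμ : IsPIMeasure μ R β Λ τ) (hδ : LipschitzWith 1 δ)
    {z : X} (hz : 0 < δ z) (hzR : ENNReal.ofReal (2 * δ z) ≤ R) {h : X → ℝ} (hh : Integrable h μ)
    (c : ℝ) : |smoothing μ δ h z - c|
      ≤ δ z * (∫ w in ball z (2 * δ z), |h w - c| ∂μ) / ∫ w, tent δ z w ∂μ := by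
  have hm := hμ.integral_tent_pos hδ.continuous hz hzR
  rw [hμ.smoothing_sub_const hδ.continuous hm hh c, abs_div, abs_of_pos hm]
  gcongr
  refine abs_integral_mul_le measurableSet_ball (fun w _ => ?_) (fun w hw => ?_)
    (hh.integrableOn.sub (integrableOn_const (hμ.ball_lt_top _ _).ne))
  · rw [abs_of_nonneg (tent_nonneg _ _)]; exact tent_le hz.le w
  · exact tent_eq_zero_of_notMem_ball hδ (by rw [dist_self]; positivity) hw

/-- A quotient rule: the numerator and the mass both vary at rate 2 in the centre. Tent averages
reproduce constants, so any `c` may be subtracted; c = h z gives the slope at z, and c = 0 gives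
local Lipschitz bounds. -/
theorem IsPIMeasure.abs_smoothing_sub_smoothing_le (hμ : IsPIMeasure μ R β Λ τ)
    (hδ : LipschitzWith 1 δ) {z z' : X} (hz : 0 < δ z) (hzR : ENNReal.ofReal (2 * δ z) ≤ R)
    (hzz : dist z z' ≤ δ z / (8 * (β ^ 2 + 1))) {h : X → ℝ} (hh : Integrable h μ) (c : ℝ) :
    |smoothing μ δ h z - smoothing μ δ h z'|
      ≤ 4 * (2 * (β ^ 2 + 1) + 1) * (∫ w in ball z (2 * δ z), |h w - c| ∂μ)
        / (∫ w, tent δ z w ∂μ) * dist z z' := by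
  have hb1 : (1 : ℝ) ≤ β ^ 2 + 1 := le_add_of_nonneg_left (by positivity)
  have hzz' : dist z z' ≤ δ z / 2 := hzz.trans (by gcongr; linarith)
  have hm := hμ.integral_tent_pos hδ.continuous hz hzR
  obtain ⟨h1, h2⟩ := hμ.half_integral_tent_le hδ hz hzR hzz
  have h3 := hμ.le_integral_tent hδ.continuous hz hzR
  set m := ∫ w, tent δ z w ∂μ with hmdef
  set m' := ∫ w, tent δ z' w ∂μ with hmdef'
  set M := μ.real (ball z (2 * δ z))
  set I := ∫ w in ball z (2 * δ z), |h w - c| ∂μ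
  have hm' : 0 < m' := lt_of_lt_of_le (half_pos hm) h2
  have hI : 0 ≤ I := integral_nonneg fun _ => abs_nonneg _
  have hd := dist_nonneg (x := z) (y := z')
  have hgi : IntegrableOn (fun w => h w - c) (ball z (2 * δ z)) μ :=
    hh.integrableOn.sub (integrableOn_const (hμ.ball_lt_top _ _).ne)
  set N := ∫ w, tent δ z w * (h w - c) ∂μ with hN
  set N' := ∫ w, tent δ z' w * (h w - c) ∂μ with hN'
  have hNi : ∀ x, Integrable (fun w => tent δ x w * (h w - c)) μ := fun x => by
    simp only [mul_sub]
    exact (integrable_tent_mul hδ.continuous hh x).sub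
      ((hμ.integrable_tent hδ.continuous x).mul_const c)
  have hNI : |N| ≤ δ z * I := by
    refine abs_integral_mul_le measurableSet_ball (fun w _ => ?_) (fun w hw => ?_) hgi
    · rw [abs_of_nonneg (tent_nonneg _ _)]; exact tent_le hz.le w
    · exact tent_eq_zero_of_notMem_ball hδ (by rw [dist_self]; positivity) hw
  have hNN : |N' - N| ≤ 2 * dist z z' * I := by
    rw [hN, hN', ← integral_sub (hNi z') (hNi z)]
    simp only [← sub_mul]
    refine abs_integral_mul_le measurableSet_ball (fun w _ => abs_tent_sub_le hδ z z' w)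
      (fun w hw => ?_) hgi
    rw [tent_eq_zero_of_notMem_ball hδ hzz' hw,
      tent_eq_zero_of_notMem_ball hδ (by rw [dist_self]; positivity) hw, sub_zero]
  have h4 : smoothing μ δ h z - smoothing μ δ h z' = -((N' - N) / m') + N * (m' - m) / (m * m') := by
    have e1 := hμ.smoothing_sub_const hδ.continuous hm hh c
    have e2 := hμ.smoothing_sub_const hδ.continuous hm' hh c
    rw [show smoothing μ δ h z - smoothing μ δ h z'
      = (smoothing μ δ h z - c) - (smoothing μ δ h z' - c) by ring, e1, e2, ← hN, ← hN', ← hmdef,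
      ← hmdef']
    field_simp
    ring
  rw [h4]
  have hinv : 1 / m' ≤ 2 / m := by
    rw [div_le_div_iff₀ hm' hm]; linarith
  have h5 : |(N' - N) / m'| ≤ 4 * I / m * dist z z' := by
    rw [abs_div, abs_of_pos hm']
    calc |N' - N| / m' = |N' - N| * (1 / m') := by ring
      _ ≤ (2 * dist z z' * I) * (2 / m) := by gcongr
      _ = 4 * I / m * dist z z' := by ring
  have h6 : |N * (m' - m) / (m * m')| ≤ 4 * (2 * (β ^ 2 + 1)) * I / m * dist z z' := by
    rw [abs_div, abs_mul, abs_of_pos (mul_pos hm hm')]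
    calc |N| * |m' - m| / (m * m') = |N| * |m' - m| / m * (1 / m') := by field_simp
      _ ≤ (δ z * I) * (2 * dist z z' * M) / m * (2 / m) := by gcongr
      _ = 4 * (δ z * M) * (I / m / m * dist z z') := by ring
      _ ≤ 4 * (2 * (β ^ 2 + 1) * m) * (I / m / m * dist z z') := by gcongr
      _ = _ := by field_simp
  calc |-((N' - N) / m') + N * (m' - m) / (m * m')|
      ≤ |(N' - N) / m'| + |N * (m' - m) / (m * m')| := by
        refine (abs_add_le _ _).trans ?_
        rw [abs_neg]
    _ ≤ 4 * I / m * dist z z' + 4 * (2 * (β ^ 2 + 1)) * I / m * dist z z' := add_le_add h5 h6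
    _ = _ := by ring

theorem IsPIMeasure.locallyLipschitzOn_smoothing (hμ : IsPIMeasure μ R β Λ τ)
    (hδ : LipschitzWith 1 δ) {A : Set X} (hA : ∀ z ∈ A, 0 < δ z)
    (hR : ∀ z, ENNReal.ofReal (2 * δ z) ≤ R) {h : X → ℝ} (hh : Integrable h μ) :
    LocallyLipschitzOn A (smoothing μ δ h) := by
  intro z₀ hz₀
  have hd0 := hA z₀ hz₀
  have hm0 := hμ.integral_tent_pos hδ.continuous hd0 (hR z₀)
  set b : ℝ := β ^ 2 + 1 with hb
  have hb1 : 1 ≤ b := le_add_of_nonneg_left (by positivity)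
  set m₀ := ∫ w, tent δ z₀ w ∂μ
  set T := ∫ w, |h w| ∂μ
  have hT : 0 ≤ T := integral_nonneg fun _ => abs_nonneg _
  -- Two points of the ball of radius η are at distance below δ z₀ / (16 b), and δ is at least δ z₀
  -- / 2 there, so the closeness condition δ z / (8 b) holds.
  set η : ℝ := δ z₀ / (32 * b) with hη
  have hη0 : 0 < η := by positivity
  have hη1 : η * (32 * b) = δ z₀ := by rw [hη]; field_simp
  refine ⟨(4 * (2 * b + 1) * T / (m₀ / 2)).toNNReal, ball z₀ η,
    mem_nhdsWithin_of_mem_nhds (ball_mem_nhds _ hη0), ?_⟩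
  refine LipschitzOnWith.of_dist_le_mul fun z hz z' hz' => ?_
  rw [Real.coe_toNNReal _ (by positivity), Real.dist_eq]
  rw [mem_ball] at hz hz'
  have hδz : δ z₀ / 2 ≤ δ z := by
    have := hδ.dist_le_mul z z₀
    rw [Real.dist_eq, NNReal.coe_one, one_mul] at this
    nlinarith [(abs_le.1 this).1]
  have hzz : dist z z' ≤ δ z / (8 * b) := by
    rw [le_div_iff₀ (by positivity)]
    have := dist_triangle_right z z' z₀
    nlinarith
  have hz0 : 0 < δ z := by linarith
  refine (hμ.abs_smoothing_sub_smoothing_le hδ hz0 (hR z) hzz hh 0).trans ?_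
  simp only [sub_zero]
  have h1 : m₀ / 2 ≤ ∫ w, tent δ z w ∂μ := by
    refine (hμ.half_integral_tent_le hδ hd0 (hR z₀) ?_).2
    rw [dist_comm, le_div_iff₀ (by positivity)]
    nlinarith
  have h2 : ∫ w in ball z (2 * δ z), |h w| ∂μ ≤ T :=
    setIntegral_le_integral hh.abs (Eventually.of_forall fun _ => abs_nonneg _)
  gcongr

end Smoothing

/-- The radius is the supremum of all r ≤ r₀ for which the ball is good. It is 1-Lipschitz because
the ball of radius r - dist x y around y lies in the ball of radius r around x; negative radii give
the empty ball, which is good. -/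
theorem exists_lipschitz_radius {X : Type*} [PseudoMetricSpace X] {Q : Set X → Prop} (hQ0 : Q ∅)
    (hQ : ∀ s t, s ⊆ t → Q t → Q s) {A : Set X} (hA : ∀ z ∈ A, ∃ s ∈ 𝓝 z, Q s) {r₀ : ℝ}
    (hr₀ : 0 < r₀) : ∃ ρ : X → ℝ, LipschitzWith 1 ρ ∧ (∀ z, 0 ≤ ρ z) ∧ (∀ z, ρ z ≤ r₀) ∧
      (∀ z ∈ A, 0 < ρ z) ∧ ∀ z, ∀ t < ρ z, Q (ball z t) := by
  let S : X → Set ℝ := fun z => {r | r ≤ r₀ ∧ Q (ball z r)}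
  have hb : ∀ z, BddAbove (S z) := fun z => ⟨r₀, fun r hr => hr.1⟩
  have h0 : ∀ z, 0 ∈ S z := fun z => ⟨hr₀.le, by rwa [ball_zero]⟩
  have hnn : ∀ z, 0 ≤ sSup (S z) := fun z => le_csSup (hb z) (h0 z)
  refine ⟨fun z => sSup (S z), ?_, hnn, fun z => csSup_le ⟨0, h0 z⟩ fun r hr => hr.1, ?_, ?_⟩
  · refine LipschitzWith.of_le_add fun x y => csSup_le ⟨0, h0 x⟩ fun r hr => ?_
    rw [← sub_le_iff_le_add]
    refine le_csSup (hb y) ⟨(sub_le_self _ dist_nonneg).trans hr.1, hQ _ _ ?_ hr.2⟩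
    refine ball_subset_ball' ?_
    rw [dist_comm]
    linarith
  · intro z hz
    obtain ⟨s, hs, hQs⟩ := hA z hz
    obtain ⟨ε, hε, hεs⟩ := Metric.mem_nhds_iff.1 hs
    refine (lt_min hr₀ hε).trans_le (le_csSup (hb z) ⟨min_le_left _ _, hQ _ _ ?_ hQs⟩)
    exact (ball_subset_ball (min_le_right _ _)).trans hεs
  · intro z t ht
    obtain ⟨r, hr, htr⟩ := exists_lt_of_lt_csSup ⟨0, h0 z⟩ ht
    exact hQ _ _ (ball_subset_ball htr.le) hr.2

/-! ### The slope of the smoothing and its integral over `Y` -/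

section

variable {X : Type*} [MetricSpace X] [MeasurableSpace X] {μ : Measure X} {δ : X → ℝ}

/-- The `L¹` oscillation of `h` around `z` at the scale of the tent function, normalized by the
mass of the tent function. -/
noncomputable def tentOsc (μ : Measure X) (δ h : X → ℝ) (z : X) : ℝ≥0∞ :=
  (∫⁻ w in ball z (2 * δ z), ‖h w - h z‖ₑ ∂μ) / ENNReal.ofReal (∫ w, tent δ z w ∂μ)

variable [BorelSpace X] {R : ℝ≥0∞} {β Λ τ : ℝ≥0}

theorem IsPIMeasure.ofReal_integral_div_tent (hμ : IsPIMeasure μ R β Λ τ) (hδ : LipschitzWith 1 δ)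
    {z : X} (hz : 0 < δ z) (hzR : ENNReal.ofReal (2 * δ z) ≤ R) {h : X → ℝ} (hh : Integrable h μ) :
    ENNReal.ofReal ((∫ w in ball z (2 * δ z), |h w - h z| ∂μ) / ∫ w, tent δ z w ∂μ)
      = tentOsc μ δ h z := by
  have hi : IntegrableOn (fun w => h w - h z) (ball z (2 * δ z)) μ :=
    hh.integrableOn.sub (integrableOn_const (hμ.ball_lt_top _ _).ne)
  rw [ENNReal.ofReal_div_of_pos (hμ.integral_tent_pos hδ.continuous hz hzR), tentOsc,
    ← ofReal_integral_norm_eq_lintegral_enorm hi]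
  rfl

theorem IsPIMeasure.enorm_smoothing_sub_le (hμ : IsPIMeasure μ R β Λ τ) (hδ : LipschitzWith 1 δ)
    {z : X} (hz : 0 < δ z) (hzR : ENNReal.ofReal (2 * δ z) ≤ R) {h : X → ℝ} (hh : Integrable h μ) :
    ‖smoothing μ δ h z - h z‖ₑ ≤ ENNReal.ofReal (δ z) * tentOsc μ δ h z := by
  rw [← hμ.ofReal_integral_div_tent hδ hz hzR hh, ← ENNReal.ofReal_mul hz.le, ← ofReal_norm,
    ← mul_div_assoc]
  exact ENNReal.ofReal_le_ofReal (hμ.abs_smoothing_sub_le hδ hz hzR hh (h z))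

theorem IsPIMeasure.eventually_edist_smoothing_le (hμ : IsPIMeasure μ R β Λ τ)
    (hδ : LipschitzWith 1 δ) {z : X} (hz : 0 < δ z) (hzR : ENNReal.ofReal (2 * δ z) ≤ R)
    {h : X → ℝ} (hh : Integrable h μ) :
    ∀ᶠ z' in 𝓝 z, edist (smoothing μ δ h z) (smoothing μ δ h z')
      ≤ (4 * (2 * (β ^ 2 + 1) + 1) * tentOsc μ δ h z) * edist z z' := by
  filter_upwards [closedBall_mem_nhds z (by positivity : 0 < δ z / (8 * (β ^ 2 + 1)))] with z' hz'
  rw [mem_closedBall, dist_comm] at hz'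
  have hm := hμ.integral_tent_pos hδ.continuous hz hzR
  have hI : 0 ≤ ∫ w in ball z (2 * δ z), |h w - h z| ∂μ := integral_nonneg fun _ => abs_nonneg _
  have h1 := hμ.abs_smoothing_sub_smoothing_le hδ hz hzR hz' hh (h z)
  have h2 : (4 * (2 * (β ^ 2 + 1) + 1) : ℝ≥0∞)
      = ENNReal.ofReal (4 * (2 * (β ^ 2 + 1) + 1) : ℝ) := by
    rw [show (4 * (2 * (β ^ 2 + 1) + 1) : ℝ) = ((4 * (2 * (β ^ 2 + 1) + 1) : ℝ≥0) : ℝ) by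
      push_cast; ring, ENNReal.ofReal_coe_nnreal]
    push_cast; ring
  rw [← hμ.ofReal_integral_div_tent hδ hz hzR hh, h2, edist_dist, edist_dist,
    ← ENNReal.ofReal_mul (by positivity), ← ENNReal.ofReal_mul (by positivity), ← mul_div_assoc]
  exact ENNReal.ofReal_le_ofReal h1

variable {Y : Type*} [MeasurableSpace Y] {ν : Measure Y}

theorem measurable_tent [SecondCountableTopology X] (hδ : Continuous δ) :
    Measurable fun p : X × X => tent δ p.1 p.2 :=
  (continuous_tent hδ).measurable

theorem measurable_integral_tent [SecondCountableTopology X] [SFinite μ] (hδ : Continuous δ) :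
    Measurable fun z => ∫ w, tent δ z w ∂μ :=
  (measurable_tent hδ).stronglyMeasurable.integral_prod_right'.measurable

theorem measurable_smoothing [SecondCountableTopology X] [SFinite μ] (hδ : Continuous δ)
    {H : X × Y → ℝ} (hH : Measurable H) :
    Measurable fun p : X × Y => smoothing μ δ (fun w => H (w, p.2)) p.1 := by
  refine Measurable.div ?_ ((measurable_integral_tent hδ).comp measurable_fst)
  have hm : Measurable fun q : (X × Y) × X => tent δ q.1.1 q.2 * H (q.2, q.1.2) :=
    ((measurable_tent hδ).comp ((measurable_fst.comp measurable_fst).prodMk measurable_snd)).mul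
      (hH.comp (measurable_snd.prodMk (measurable_snd.comp measurable_fst)))
  exact hm.stronglyMeasurable.integral_prod_right'.measurable

theorem measurable_tentOsc [SecondCountableTopology X] [SFinite μ] (hδ : Continuous δ)
    {H : X × Y → ℝ} (hH : Measurable H) :
    Measurable fun p : X × Y => tentOsc μ δ (fun w => H (w, p.2)) p.1 := by
  refine Measurable.div ?_ ((measurable_integral_tent hδ).ennreal_ofReal.comp measurable_fst)
  have hB : MeasurableSet {q : (X × Y) × X | dist q.2 q.1.1 < 2 * δ q.1.1} :=
    measurableSet_lt (measurable_snd.dist (measurable_fst.comp measurable_fst))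
      ((hδ.measurable.comp (measurable_fst.comp measurable_fst)).const_mul 2)
  have hm : Measurable ({q : (X × Y) × X | dist q.2 q.1.1 < 2 * δ q.1.1}.indicator
      fun q => ‖H (q.2, q.1.2) - H q.1‖ₑ) :=
    ((hH.comp (measurable_snd.prodMk (measurable_snd.comp measurable_fst))).sub
      (hH.comp measurable_fst)).enorm.indicator hB
  convert hm.lintegral_prod_right' (ν := μ) using 2 with p
  rw [← lintegral_indicator measurableSet_ball]
  rfl

/-- By Tonelli the integral over `Y` is the average-type integral of the L¹(Y) distance between the
values at w and z, at most 2Lδ z on the ball. Its quotient by the mass of the tent is then bounded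
by `le_integral_tent`. -/
theorem IsPIMeasure.lintegral_tentOsc_le [SFinite ν] (hμ : IsPIMeasure μ R β Λ τ)
    (hδ : LipschitzWith 1 δ) {z : X} (hz : 0 < δ z) (hzR : ENNReal.ofReal (2 * δ z) ≤ R)
    {H : X × Y → ℝ} (hH : Measurable H) {L : ℝ≥0}
    (hL : ∀ᵐ w ∂μ.restrict (ball z (2 * δ z)),
      ∫⁻ y, ‖H (w, y) - H (z, y)‖ₑ ∂ν ≤ L * edist w z) :
    ∫⁻ y, tentOsc μ δ (fun w => H (w, y)) z ∂ν ≤ 4 * (β ^ 2 + 1) * L := by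
  have := hμ.sigmaFinite
  have hm := hμ.integral_tent_pos hδ.continuous hz hzR
  simp only [tentOsc, div_eq_mul_inv]
  rw [lintegral_mul_const' _ _ (ENNReal.inv_ne_top.2 (ENNReal.ofReal_pos.2 hm).ne'),
    ← div_eq_mul_inv]
  refine ENNReal.div_le_of_le_mul ?_
  rw [lintegral_lintegral_swap]
  · calc ∫⁻ w in ball z (2 * δ z), ∫⁻ y, ‖H (w, y) - H (z, y)‖ₑ ∂ν ∂μ
        ≤ ∫⁻ _ in ball z (2 * δ z), L * ENNReal.ofReal (2 * δ z) ∂μ := by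
          refine lintegral_mono_ae ?_
          filter_upwards [hL, ae_restrict_mem measurableSet_ball] with w hw hwB
          refine hw.trans ?_
          rw [edist_dist]
          gcongr
          exact hwB.le
      _ = L * (ENNReal.ofReal (2 * δ z) * μ (ball z (2 * δ z))) := by
          rw [setLIntegral_const, mul_assoc]
      _ ≤ L * (ENNReal.ofReal (4 * (β ^ 2 + 1)) * ENNReal.ofReal (∫ w, tent δ z w ∂μ)) := by
          rw [← ENNReal.ofReal_toReal (hμ.ball_lt_top z (2 * δ z)).ne,
            ← ENNReal.ofReal_mul (by positivity), ← ENNReal.ofReal_mul (by positivity)]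
          refine mul_le_mul' le_rfl (ENNReal.ofReal_le_ofReal ?_)
          have := hμ.le_integral_tent hδ.continuous hz hzR
          rw [Measure.real] at this
          linarith
      _ = _ := by
          rw [show (4 * (β ^ 2 + 1) : ℝ) = ((4 * (β ^ 2 + 1) : ℝ≥0) : ℝ) by push_cast; ring,
            ENNReal.ofReal_coe_nnreal]
          push_cast; ring
  · exact ((hH.comp (measurable_snd.prodMk measurable_fst)).sub
      (hH.comp (measurable_const.prodMk measurable_fst))).enorm.aemeasurable

end

theorem lintegral_setLIntegral_swap {α Y : Type*} [MeasurableSpace α] [MeasurableSpace Y]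
    {μ : Measure α} {ν : Measure Y} [SFinite μ] [SFinite ν] (A : Set α) {G : α × Y → ℝ≥0∞}
    (hG : Measurable G) :
    ∫⁻ y, ∫⁻ z in A, G (z, y) ∂μ ∂ν = ∫⁻ z in A, ∫⁻ y, G (z, y) ∂ν ∂μ :=
  lintegral_lintegral_swap (f := fun y z => G (z, y)) (hG.comp measurable_swap).aemeasurable

/-! ### The total perimeter of a Lipschitz map -/

section

variable {X Y : Type*} [MetricSpace X] [MeasurableSpace X] [BorelSpace X] [MeasurableSpace Y]
  {μ : Measure X} {ν : Measure Y} {R : ℝ≥0∞} {β Λ τ : ℝ≥0}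

theorem IsPIMeasure.lintegral_variation_sliceInd_le_tentOsc (hμ : IsPIMeasure μ R β Λ τ)
    {A : Set X} (hA : IsOpen A) (hμA : μ A ≠ ∞) {δ : ℕ → X → ℝ} (hδ : ∀ n, LipschitzWith 1 (δ n))
    (hδ0 : ∀ n, ∀ z ∈ A, 0 < δ n z) (hδR : ∀ n z, ENNReal.ofReal (2 * δ n z) ≤ R)
    {h : X → ℝ} (hm : Measurable h) (hh : Integrable h μ)
    (hSm : ∀ n, Measurable (smoothing μ (δ n) h)) (hOm : ∀ n, Measurable (tentOsc μ (δ n) h))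
    (hsum : ∑' n, ∫⁻ z in A, ENNReal.ofReal (δ n z) * tentOsc μ (δ n) h z ∂μ ≠ ∞) :
    ∫⁻ t, variation μ (fun x => sliceInd t (h x)) A ≤ 8 * (2 * (β ^ 2 + 1) + 1) *
      liminf (fun n => ∫⁻ z in A, tentOsc μ (δ n) h z ∂μ) atTop := by
  have := hμ.sigmaFinite
  have hK : (4 * (2 * (β ^ 2 + 1) + 1) : ℝ≥0∞) ≠ ∞ := by finiteness
  refine (lintegral_variation_sliceInd_le hA hμA hm hSm
    (fun n => hμ.locallyLipschitzOn_smoothing (hδ n) (hδ0 n) (hδR n) hh)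
    (D := fun n z => 4 * (2 * (β ^ 2 + 1) + 1) * tentOsc μ (δ n) h z)
    (fun n => (hOm n).const_mul _)
    (fun n z hz => hμ.eventually_edist_smoothing_le (hδ n) (hδ0 n z hz) (hδR n z) hh)
    (ne_top_of_le_ne_top hsum (ENNReal.tsum_le_tsum fun n => ?_))).trans_eq ?_
  · exact setLIntegral_mono' hA.measurableSet fun z hz =>
      hμ.enorm_smoothing_sub_le (hδ n) (hδ0 n z hz) (hδR n z) hh
  · simp only [lintegral_const_mul' _ _ hK]
    rw [ENNReal.liminf_const_mul_of_ne_top hK, ← mul_assoc]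
    congr 1
    ring

/-- The smoothings converge in L¹(A) for almost every y because the error is at most δ n times
`tentOsc`, and δ n ≤ 2^(-n) makes the errors summable after integration over `Y`. A second use of
Fatou, in y, gives 8(2(β² + 1) + 1) times 4(β² + 1)L μ(A). -/
theorem IsPIMeasure.lintegral_lintegral_variation_sliceInd_le [SFinite ν]
    (hμ : IsPIMeasure μ R β Λ τ) {A : Set X} (hA : IsOpen A) (hμA : μ A ≠ ∞) {δ : ℕ → X → ℝ}
    (hδ : ∀ n, LipschitzWith 1 (δ n)) (hδ0 : ∀ n, ∀ z ∈ A, 0 < δ n z)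
    (hδR : ∀ n z, ENNReal.ofReal (2 * δ n z) ≤ R) (hδn : ∀ n z, δ n z ≤ (1 / 2) ^ n)
    {H : X × Y → ℝ} (hH : Measurable H) (hHi : Integrable H (μ.prod ν)) {L : ℝ≥0}
    (hL : ∀ᵐ z ∂μ.restrict A, ∀ n, ∀ᵐ w ∂μ.restrict (ball z (2 * δ n z)),
      ∫⁻ y, ‖H (w, y) - H (z, y)‖ₑ ∂ν ≤ L * edist w z) :
    ∫⁻ y, (∫⁻ t, variation μ (fun x => sliceInd t (H (x, y))) A) ∂ν
      ≤ 32 * (β ^ 2 + 1) * (2 * (β ^ 2 + 1) + 1) * L * μ A := by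
  have := hμ.sigmaFinite
  have := hμ.secondCountableTopology
  have hK : (8 * (2 * (β ^ 2 + 1) + 1) : ℝ≥0∞) ≠ ∞ := by finiteness
  have hO : ∀ n, Measurable fun p : X × Y => tentOsc μ (δ n) (fun w => H (w, p.2)) p.1 :=
    fun n => measurable_tentOsc (hδ n).continuous hH
  have hOL : ∀ n, ∀ᵐ z ∂μ.restrict A,
      ∫⁻ y, tentOsc μ (δ n) (fun w => H (w, y)) z ∂ν ≤ 4 * (β ^ 2 + 1) * L := fun n => by
    filter_upwards [hL, ae_restrict_mem hA.measurableSet] with z hz hzA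
    exact hμ.lintegral_tentOsc_le (hδ n) (hδ0 n z hzA) (hδR n z) hH (hz n)
  have hG : ∀ n, Measurable fun p : X × Y =>
      ENNReal.ofReal (δ n p.1) * tentOsc μ (δ n) (fun w => H (w, p.2)) p.1 := fun n =>
    ((hδ n).continuous.measurable.comp measurable_fst).ennreal_ofReal.mul (hO n)
  have hsum : ∀ᵐ y ∂ν, ∑' n, ∫⁻ z in A,
      ENNReal.ofReal (δ n z) * tentOsc μ (δ n) (fun w => H (w, y)) z ∂μ < ∞ := by
    have hGm : ∀ n, Measurable fun y => ∫⁻ z in A,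
        ENNReal.ofReal (δ n z) * tentOsc μ (δ n) (fun w => H (w, y)) z ∂μ := fun n =>
      ((hG n).comp measurable_swap).lintegral_prod_right'
    refine ae_lt_top (Measurable.tsum hGm) ?_
    rw [lintegral_tsum fun n => (hGm n).aemeasurable]
    have hle : ∀ n, ∫⁻ y, ∫⁻ z in A,
        ENNReal.ofReal (δ n z) * tentOsc μ (δ n) (fun w => H (w, y)) z ∂μ ∂ν
          ≤ (2⁻¹ : ℝ≥0∞) ^ n * (4 * (β ^ 2 + 1) * L * μ A) := fun n => by
      rw [lintegral_setLIntegral_swap A (hG n), ← mul_assoc,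
        ← setLIntegral_const]
      refine lintegral_mono_ae ?_
      filter_upwards [hOL n] with z hz
      rw [lintegral_const_mul' _ _ ENNReal.ofReal_ne_top]
      refine mul_le_mul' ((ENNReal.ofReal_le_ofReal (hδn n z)).trans_eq ?_) hz
      rw [ENNReal.ofReal_pow (by norm_num), one_div, ENNReal.ofReal_inv_of_pos two_pos,
        ENNReal.ofReal_ofNat]
    refine ne_top_of_le_ne_top ?_ (ENNReal.tsum_le_tsum hle)
    rw [ENNReal.tsum_mul_right]
    refine ENNReal.mul_ne_top ?_ (ENNReal.mul_ne_top (by finiteness) hμA)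
    rw [ENNReal.tsum_geometric]
    simp
  calc ∫⁻ y, (∫⁻ t, variation μ (fun x => sliceInd t (H (x, y))) A) ∂ν
      ≤ ∫⁻ y, 8 * (2 * (β ^ 2 + 1) + 1) *
          liminf (fun n => ∫⁻ z in A, tentOsc μ (δ n) (fun w => H (w, y)) z ∂μ) atTop ∂ν := by
        refine lintegral_mono_ae ?_
        filter_upwards [hsum, hHi.prod_left_ae] with y hy hyi
        exact hμ.lintegral_variation_sliceInd_le_tentOsc hA hμA hδ hδ0 hδR
          (hH.comp measurable_prodMk_right) hyi
          (fun n => (measurable_smoothing (hδ n).continuous hH).comp measurable_prodMk_right)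
          (fun n => (hO n).comp measurable_prodMk_right) hy.ne
    _ ≤ 8 * (2 * (β ^ 2 + 1) + 1) * liminf (fun n => ∫⁻ y, ∫⁻ z in A,
          tentOsc μ (δ n) (fun w => H (w, y)) z ∂μ ∂ν) atTop := by
        rw [lintegral_const_mul' _ _ hK]
        gcongr
        exact lintegral_liminf_le fun n => ((hO n).comp measurable_swap).lintegral_prod_right'
    _ ≤ 8 * (2 * (β ^ 2 + 1) + 1) * (4 * (β ^ 2 + 1) * L * μ A) := by
        gcongr
        refine liminf_le_of_le ?_ fun b hb => ?_
        · isBoundedDefault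
        obtain ⟨n, hn⟩ := hb.exists
        refine hn.trans ?_
        rw [lintegral_setLIntegral_swap A (hO n),
          ← setLIntegral_const]
        exact lintegral_mono_ae (hOL n)
    _ = _ := by ring

/-- The smoothing radius is chosen below the largest one for which the ball lies in `A` and `F` is
L-Lipschitz on it. A local Lipschitz condition therefore suffices, and nothing outside `A`
contributes. -/
theorem IsPIMeasure.totalPerimeter_le_of_lipschitz [SFinite ν] (hμ : IsPIMeasure μ R β Λ τ)
    (hR : 0 < R) {U : Set X} (hU : IsOpen U) {f F : X → Lp ℝ 1 ν}
    (hf : MemLp f 1 (μ.restrict U)) (hFf : F =ᵐ[μ.restrict U] f) {L : ℝ≥0}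
    (hF : ∀ x ∈ U, ∃ s ∈ 𝓝 x, LipschitzOnWith L F s) {A : Set X} (hA : IsOpen A) (hAU : A ⊆ U)
    (hμA : μ A ≠ ∞) :
    totalPerimeter μ U (cutMeasure (μ.restrict U) ν f) A
      ≤ 32 * (β ^ 2 + 1) * (2 * (β ^ 2 + 1) + 1) * L * μ A := by
  have := hμ.sigmaFinite
  obtain ⟨H, hH, hHi, hHf, hHt⟩ := exists_measurable_jointFunction hf
  have hUm : MeasurableSet (U ×ˢ univ : Set (X × Y)) := hU.measurableSet.prod MeasurableSet.univ
  -- `H` is integrable only over `U`, while the smoothing integrates over `X`; cutting off by zero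
  -- does not change the values over `A`.
  set H₁ : X × Y → ℝ := (U ×ˢ univ).indicator H with hH₁
  have hH₁i : Integrable H₁ (μ.prod ν) := by
    rw [hH₁, integrable_indicator_iff hUm, IntegrableOn, ← Measure.prod_restrict,
      Measure.restrict_univ]
    exact hHi
  have hHH : ∀ z ∈ U, ∀ y, H₁ (z, y) = H (z, y) := fun z hz y =>
    indicator_of_mem (by exact ⟨hz, mem_univ _⟩) _
  obtain ⟨r₀, hr₀, hr₀1, hr₀R⟩ : ∃ r₀ : ℝ, 0 < r₀ ∧ r₀ ≤ 1 ∧ ENNReal.ofReal r₀ ≤ R := by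
    have hne : min 1 R ≠ ∞ := ne_top_of_le_ne_top ENNReal.one_ne_top (min_le_left _ _)
    refine ⟨(min 1 R).toReal, ENNReal.toReal_pos (lt_min one_pos hR).ne' hne, ?_, ?_⟩
    · simpa using ENNReal.toReal_mono ENNReal.one_ne_top (min_le_left 1 R)
    · rw [ENNReal.ofReal_toReal hne]; exact min_le_right _ _
  obtain ⟨ρ, hρ, hρ0, hρr, hρA, hρQ⟩ := exists_lipschitz_radius
    (Q := fun s => s ⊆ A ∧ LipschitzOnWith L F s) ⟨empty_subset _, by simp⟩
    (fun s t hst h => ⟨hst.trans h.1, h.2.mono hst⟩) (A := A) (fun z hz => by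
      obtain ⟨s, hs, hsL⟩ := hF z (hAU hz)
      exact ⟨s ∩ A, inter_mem hs (hA.mem_nhds hz), inter_subset_right,
        hsL.mono inter_subset_left⟩) hr₀
  -- The exponent n + 2 gives 2 δ n ≤ ρ / 2, so the balls of radius 2 δ n z are strictly smaller
  -- than the good radius ρ z when z is in `A`.
  let δ : ℕ → X → ℝ := fun n z => (1 / 2) ^ (n + 2) * ρ z
  have hp : ∀ n, (0 : ℝ) < (1 / 2) ^ (n + 2) := fun n => by positivity
  have hp4 : ∀ n, (1 / 2 : ℝ) ^ (n + 2) ≤ 1 / 4 := fun n => by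
    rw [pow_add]
    linarith [pow_le_one₀ (n := n) (by norm_num : (0 : ℝ) ≤ 1 / 2) (by norm_num)]
  have hδ2 : ∀ n z, 2 * δ n z ≤ ρ z / 2 := fun n z => by
    have := mul_le_mul_of_nonneg_right (hp4 n) (hρ0 z)
    change 2 * ((1 / 2) ^ (n + 2) * ρ z) ≤ _
    linarith
  have hL : ∀ᵐ z ∂μ.restrict A, ∀ n, ∀ᵐ w ∂μ.restrict (ball z (2 * δ n z)),
      ∫⁻ y, ‖H₁ (w, y) - H₁ (z, y)‖ₑ ∂ν ≤ L * edist w z := by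
    have hHF : ∀ᵐ z ∂μ.restrict U, (fun y => H (z, y)) =ᵐ[ν] F z := by
      filter_upwards [hHf, hFf] with z h1 h2
      rwa [h2]
    filter_upwards [ae_restrict_of_ae_restrict_of_subset hAU hHF,
      ae_restrict_mem hA.measurableSet] with z hz hzA n
    obtain ⟨hBA, hBL⟩ := hρQ z (2 * δ n z) ((hδ2 n z).trans_lt (half_lt_self (hρA z hzA)))
    filter_upwards [ae_restrict_of_ae_restrict_of_subset (hBA.trans hAU) hHF,
      ae_restrict_mem measurableSet_ball] with w hw hwB
    simp only [hHH z (hAU hzA), hHH w (hAU (hBA hwB))]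
    rw [← edist_Lp_one_of_ae_eq hw hz]
    exact hBL hwB (mem_ball_self (mul_pos two_pos (mul_pos (hp n) (hρA z hzA))))
  have key := hμ.lintegral_lintegral_variation_sliceInd_le hA hμA (δ := δ) (fun n => ?_)
    (fun n z hz => mul_pos (hp n) (hρA z hz)) (fun n z => ?_) (fun n z => ?_)
    (hH.indicator hUm) hH₁i hL
  · refine (lintegral_cutMeasure_le f _).trans (le_trans (lintegral_mono_ae ?_) key)
    filter_upwards [hHt] with y hy
    refine lintegral_mono fun t => ?_
    rw [perimeterMeasure_of_isOpen hA hAU]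
    refine variation_le_of_ae_eq ?_
    filter_upwards [ae_restrict_of_ae_restrict_of_subset hAU
      (slice_coe_ae_eq (transpose (μ.restrict U) ν f y) t),
      ae_restrict_of_ae_restrict_of_subset hAU hy, ae_restrict_mem hA.measurableSet] with x h1 h2 h3
    rw [h1, h2, ← hHH x (hAU h3)]
  · refine LipschitzWith.of_dist_le_mul fun x y => ?_
    rw [Real.dist_eq, ← mul_sub, abs_mul, abs_of_pos (hp n)]
    have h1 := hρ.dist_le_mul x y
    rw [Real.dist_eq] at h1
    refine (mul_le_of_le_one_left (abs_nonneg _) ((hp4 n).trans (by norm_num))).trans h1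
  · refine (ENNReal.ofReal_le_ofReal ?_).trans hr₀R
    linarith [hδ2 n z, hρ0 z, hρr z]
  · change (1 / 2) ^ (n + 2) * ρ z ≤ _
    refine (mul_le_of_le_one_right (hp n).le ((hρr z).trans hr₀1)).trans ?_
    exact pow_le_pow_of_le_one (by norm_num) (by norm_num) (by omega)

end

end TotalPerimeter

theorem mainTheorem9 (β Λ τ : ℝ≥0) (hΛ : 1 ≤ Λ) :
    ∃ C : ℝ≥0, ∀ (X : Type*) [MetricSpace X] [CompleteSpace X] [MeasurableSpace X] [BorelSpace X]
      (μ : Measure X) (R : ℝ≥0∞), 0 < R → TotalPerimeter.IsPIMeasure μ R β Λ τ →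
      ∀ (Y : Type*) [MeasurableSpace Y] (ν : Measure Y) [SigmaFinite ν]
        (U : Set X), IsOpen U →
      ∀ f : X → Lp ℝ 1 ν, TotalPerimeter.IsBV μ U f →
      ∀ L : ℝ≥0,
        -- a (locally) `L`-Lipschitz representative forces the bound on all balls
        ((∃ F : X → Lp ℝ 1 ν, F =ᵐ[μ.restrict U] f ∧
            ∀ x ∈ U, ∃ s ∈ 𝓝 x, LipschitzOnWith L F s) →
          ∀ (x : X) (r : ℝ), 0 < r →
            TotalPerimeter.totalPerimeter μ U
                (TotalPerimeter.cutMeasure (μ.restrict U) ν f) (ball x r ∩ U)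
              ≤ C * L * μ (ball x r ∩ U)) ∧
        -- the bound on all balls contained in `U` gives a Lipschitz representative
        ((∀ (x : X) (r : ℝ), 0 < r → ball x r ⊆ U →
            TotalPerimeter.totalPerimeter μ U
                (TotalPerimeter.cutMeasure (μ.restrict U) ν f) (ball x r)
              ≤ L * μ (ball x r)) →
          ∃ F : X → Lp ℝ 1 ν, F =ᵐ[μ.restrict U] f ∧
            -- at distances comparable with the distance to the complement of `U`
            (∀ x ∈ U, ∀ y ∈ U, C * edist x y ≤ R → ball x (C * dist x y) ⊆ U →
              edist (F x) (F y) ≤ C * L * edist x y) ∧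
            -- with respect to the inner length distance of `U`
            (∀ γ : ℝ → X, ContinuousOn γ (Icc 0 1) → MapsTo γ (Icc 0 1) U →
              edist (F (γ 0)) (F (γ 1)) ≤ C * L * eVariationOn γ (Icc 0 1)) ∧
            -- on all of `U`, if `U` is quasiconvex
            (∀ Q : ℝ≥0, (∀ x ∈ U, ∀ y ∈ U, ∃ γ : ℝ → X, ContinuousOn γ (Icc 0 1) ∧
                MapsTo γ (Icc 0 1) U ∧ γ 0 = x ∧ γ 1 = y ∧
                eVariationOn γ (Icc 0 1) ≤ Q * edist x y) →
              LipschitzOnWith (C * L * Q) F U) ∧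
            -- on all of `X`, if `U = X` and the PI conditions hold at all scales
            (U = univ → R = ∞ → LipschitzWith (C * L) F)) := by
  obtain ⟨k, hk2, hkΛ⟩ : ∃ k : ℕ, 2 ≤ k ∧ Λ < 2 ^ k := by
    obtain ⟨k, hk⟩ := pow_unbounded_of_one_lt Λ one_lt_two
    exact ⟨max 2 k, le_max_left _ _,
      hk.trans_le (pow_le_pow_right₀ one_le_two (le_max_right _ _))⟩
  set C₁ : ℝ≥0 := 2 * 2 ^ k with hC₁
  set C₂ : ℝ≥0 := 16 * (τ + 1) * β ^ (k + 2) with hC₂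
  set C₃ : ℝ≥0 := 32 * (β ^ 2 + 1) * (2 * (β ^ 2 + 1) + 1) with hC₃
  -- `C₁` governs the radius of the ball required in `U`, `C₂` the Lipschitz constant and `C₃` the
  -- perimeter bound. Every conclusion only weakens as the constant grows, so one sum serves all.
  refine ⟨C₁ + C₂ + C₃, ?_⟩
  intro X _ _ _ _ μ R hR hμ Y _ ν _ U hU f hf L
  have hCC₁ : C₁ ≤ C₁ + C₂ + C₃ := by rw [add_assoc]; exact le_self_add
  have hCC₂ : C₂ ≤ C₁ + C₂ + C₃ := le_add_right le_add_self
  have hCC₃ : C₃ ≤ C₁ + C₂ + C₃ := le_add_self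
  generalize C₁ + C₂ + C₃ = C at hCC₁ hCC₂ hCC₃
  refine ⟨?_, fun hL => ?_⟩
  · rintro ⟨F, hFf, hF⟩ x r -
    have h := hμ.totalPerimeter_le_of_lipschitz hR hU hf.1 hFf hF (isOpen_ball.inter hU)
      inter_subset_right
      (ne_top_of_le_ne_top (hμ.ball_lt_top x r).ne (measure_mono inter_subset_left))
    refine h.trans ?_
    have h3 : ((C₃ : ℝ≥0) : ℝ≥0∞) ≤ C := by exact_mod_cast hCC₃
    rw [hC₃] at h3
    push_cast at h3
    gcongr
  · obtain ⟨F, hFf, hF⟩ := TotalPerimeter.IsPIMeasure.exists_lipschitz_of_totalPerimeter_le hμ hΛ hR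
      hU hf.1 hL hk2 hkΛ hCC₁ hCC₂
    have hcurve : ∀ γ : ℝ → X, ContinuousOn γ (Icc 0 1) → MapsTo γ (Icc 0 1) U →
        edist (F (γ 0)) (F (γ 1)) ≤ C * L * eVariationOn γ (Icc 0 1) := fun γ hγ hγU => by
      have hK := TotalPerimeter.edist_le_mul_eVariationOn_of_ball_subset (C := C) (K := C * L) hU hR
        (by simpa using hF) hγ hγU
      simpa using hK
    refine ⟨F, hFf, hF, hcurve, fun Q hQ x hx y hy => ?_, fun hUX hRt x y => ?_⟩
    · obtain ⟨γ, hγ, hγU, rfl, rfl, hl⟩ := hQ x hx y hy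
      refine (hcurve γ hγ hγU).trans ?_
      push_cast
      rw [mul_assoc (_ * _)]
      gcongr
    · have h := hF x (hUX ▸ mem_univ x) y (hUX ▸ mem_univ y) (hRt ▸ le_top)
        (hUX ▸ subset_univ _)
      simpa using h
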